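/- Let $\mathcal{E}$ be a complex Hilbert space, let $\mu$ be normalized Lebesgue measure on the unit circle $\mathbb{T}$, and let $\Phi\in L^\infty_{\mathcal{B}(\mathcal{E})}(\mathbb{T})$, that is, $\Phi:\mathbb{T}\to\mathcal{B}(\mathcal{E})$ is essentially bounded and $z\mapsto\Phi(z)x$ and $z\mapsto\Phi(z)^*x$ are strongly measurable for every $x\in\mathcal{E}$. Regard $H^2_{\mathcal{E}}(\mathbb{D})$, through boundary values, as the closed subspace of $L^2_{\mathcal{E}}(\mathbb{T})$ of functions whose Fourier coefficients of negative index vanish, and let $T_\Phi=P_{H^2_{\mathcal{E}}(\mathbb{D})}L_\Phi|_{H^2_{\mathcal{E}}(\mathbb{D})}$ be the Toeplitz operator with symbol $\Phi$, where $L_\Phi f=\Phi f$ on $L^2_{\mathcal{E}}(\mathbb{T})$. Assume that $T_\Phi$ is a contraction, $\|T_\Phi\|\le 1$. A bounded operator $T$ on a Hilbert space has a unitary part if there is a non-zero closed $T$-reducing subspace $\mathcal{M}$ such that $T|_{\mathcal{M}}:\mathcal{M}\to\mathcal{M}$ is unitary; otherwise $T$ is completely non-unitary. For a Hilbert space $\mathcal{F}$,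 an inner function $\Theta\in H^\infty_{\mathcal{B}(\mathcal{F},\mathcal{E})}(\mathbb{D})$ is a bounded analytic function $\Theta:\mathbb{D}\to\mathcal{B}(\mathcal{F},\mathcal{E})$ which at almost every $z\in\mathbb{T}$ has a radial limit $\Theta(z)$ in the strong operator topology, with $\Theta(z)$ an isometry for almost every $z \in \mathbb{T}$. Suppose that one of the following conditions holds. (I) There is a measurable set $N\subseteq\mathbb{T}$ with $\mu(N)>0$ such that $\Phi(z)$ is completely non-unitary for almost every $z\in N$. (II) $\Phi(z)$ has a unitary part for almost every $z\in\mathbb{T}$, but for no non-zero Hilbert space $\mathcal{F}$ and no unitary $U\in\mathcal{B}(\mathcal{F})$ does there exist an inner function $\Theta\in H^\infty_{\mathcal{B}(\mathcal{F},\mathcal{E})}(\mathbb{D})$ such that $$\Phi(z)\Theta(z)=\Theta(z)U\quad\text{and}\quad\Phi(z)^*\Theta(z)=\Theta(z)U^*\qquad\text{for almost every } z\in\mathbb{T}.$$ Then $T_\Phi$ is completely non-unitary. Moreover, for every analytic $u:\mathbb{D}\to\mathbb{C}$, not identically zero, with $|u(z)|<1$ for all $z\in\mathbb{D}$, the operator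 $u(T_\Phi)$ exists in the sense of the Sz.-Nagy--Foias functional calculus, and it is a completely non-unitary contraction. Here, if $u(z)=\sum_{n\ge0}a_nz^n$, then $u(T_\Phi)$ is the limit in the strong operator topology, as $r\to1^-$, of the operators $u(rT_\Phi)=\sum_{n\ge0}a_nr^nT_\Phi^n$ ($0\le r<1$), where the series converge in operator norm. -/

import Mathlib

open MeasureTheory Filter Topology AddCircle

universe u

noncomputable section

namespace UnitaryToeplitz

/-! ### Completely non-unitary operators -/

section Operators

variable {H : Type u} [NormedAddCommGroup H] [InnerProductSpace ℂ H]

/-- The closed subspace `M` reduces `T`: both `M` and its orthogonal complement are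
`T`-invariant. -/
structure IsReducing (T : H →L[ℂ] H) (M : Submodule ℂ H) : Prop where
  isClosed : IsClosed (M : Set H)
  mapsTo : ∀ x ∈ M, T x ∈ M
  mapsTo_orthogonal : ∀ x ∈ Mᗮ, T x ∈ Mᗮ

/-- `T` restricts to a unitary operator of `M` onto `M`. -/
structure IsUnitaryOn (T : H →L[ℂ] H) (M : Submodule ℂ H) : Prop where
  mapsTo : ∀ x ∈ M, T x ∈ M
  norm_map : ∀ x ∈ M, ‖T x‖ = ‖x‖
  surjOn : ∀ y ∈ M, ∃ x ∈ M, T x = y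

/-- `T` has a unitary part: some non-zero reducing subspace on which `T` is unitary. -/
def HasUnitaryPart (T : H →L[ℂ] H) : Prop :=
  ∃ M : Submodule ℂ H, M ≠ ⊥ ∧ IsReducing T M ∧ IsUnitaryOn T M

/-- `T` is completely non-unitary. -/
def IsCNU (T : H →L[ℂ] H) : Prop := ¬ HasUnitaryPart T

/-- The `n`-th Taylor coefficient at the origin. -/
def taylorCoeff (f : ℂ → ℂ) (n : ℕ) : ℂ := iteratedDeriv n f 0 / (n.factorial : ℂ)

/-- `A = f(T)` in the sense of the Sz.-Nagy--Foias functional calculus: for `0 ≤ r < 1` the series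
`f(rT) = ∑ aₙ rⁿ Tⁿ` (where `f(z) = ∑ aₙ zⁿ`) converges in operator norm, and `f(rT)` converges
strongly to `A` as `r → 1-`. -/
structure IsFunctionalCalculus (f : ℂ → ℂ) (T A : H →L[ℂ] H) : Prop where
  summable : ∀ r : ℝ, 0 ≤ r → r < 1 →
    Summable fun n : ℕ => (taylorCoeff f n * (r : ℂ) ^ n) • T ^ n
  tendsto : ∀ x : H,
    Tendsto (fun r : ℝ => (∑' n : ℕ, (taylorCoeff f n * (r : ℂ) ^ n) • T ^ n) x)
      (𝓝[<] 1) (𝓝 (A x))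

end Operators

/-! ### Vector-valued `L²` and `H²` on the circle

The circle is `ℝ/ℤ`, with the point `t` standing for `toCircle t = exp (2 π i t)`, and it carries
the normalized Lebesgue measure `haarAddCircle`. -/

/-- The unit circle, parametrized by `t ↦ toCircle t = exp (2 π i t)`. -/
abbrev Torus : Type := AddCircle (1 : ℝ)

/-- Normalized Lebesgue measure on the circle. -/
abbrev leb : Measure Torus := haarAddCircle

section Spaces

variable (E : Type u) [NormedAddCommGroup E] [InnerProductSpace ℂ E]

/-- The Hilbert space of square-integrable `E`-valued functions on the circle. -/
abbrev LTwo : Type u := Lp E 2 leb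

variable {E}

theorem norm_fourierCoeff_le (f : LTwo E) (n : ℤ) :
    ‖fourierCoeff (f : Torus → E) n‖ ≤ ‖f‖ := by
  have h1 : ‖fourierCoeff (f : Torus → E) n‖ ≤ ∫ t, ‖(f : Torus → E) t‖ ∂leb := by
    refine (norm_integral_le_integral_norm _).trans (le_of_eq ?_)
    refine integral_congr_ae (Eventually.of_forall fun t => ?_)
    simp only [norm_smul, fourier_apply, Circle.norm_coe, one_mul]
  refine h1.trans ?_
  rw [integral_norm_eq_lintegral_enorm (Lp.aestronglyMeasurable f), ← eLpNorm_one_eq_lintegral_enorm,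
    Lp.norm_def]
  exact ENNReal.toReal_mono (Lp.eLpNorm_ne_top f)
    (eLpNorm_le_eLpNorm_of_exponent_le (by norm_num) (Lp.aestronglyMeasurable f))

/-- The `n`-th Fourier coefficient as a linear map on `L²`. -/
def fourierCoeffLinear (n : ℤ) : LTwo E →ₗ[ℂ] E where
  toFun f := fourierCoeff (f : Torus → E) n
  map_add' f g := by
    have h := congrFun (fourierCoeff.add ((Lp.memLp f).integrable (by norm_num))
      ((Lp.memLp g).integrable (by norm_num))) n
    rw [Pi.add_apply] at h
    rw [← h]
    refine integral_congr_ae ?_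
    filter_upwards [Lp.coeFn_add f g] with t ht
    simp only [ht, Pi.add_apply]
  map_smul' c f := by
    rw [RingHom.id_apply, ← fourierCoeff.const_smul]
    refine integral_congr_ae ?_
    filter_upwards [Lp.coeFn_smul c f] with t ht
    simp only [ht, Pi.smul_apply]

/-- The `n`-th Fourier coefficient as a continuous linear map on `L²`. -/
def fourierCoeffCLM (n : ℤ) : LTwo E →L[ℂ] E :=
  (fourierCoeffLinear n).mkContinuous 1 fun f => by
    simpa [fourierCoeffLinear] using norm_fourierCoeff_le f n

variable (E)

/-- The `E`-valued Hardy space `H²`, identified as usual, through boundary values, with the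
subspace of those functions in `L²` all of whose Fourier coefficients of negative index vanish
(`∑ aₙ zⁿ` with `∑ ‖aₙ‖² < ∞` corresponds to the function with Fourier coefficients `aₙ`). -/
def HTwo : Submodule ℂ (LTwo E) where
  carrier := {f | ∀ n : ℤ, n < 0 → fourierCoeff (f : Torus → E) n = 0}
  zero_mem' := fun n _ => (fourierCoeffLinear (E := E) n).map_zero
  add_mem' := fun {f g} hf hg n hn => by
    have h : fourierCoeffLinear n (f + g) =
        fourierCoeff (f : Torus → E) n + fourierCoeff (g : Torus → E) n :=
      (fourierCoeffLinear (E := E) n).map_add f g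
    rw [hf n hn, hg n hn, add_zero] at h
    exact h
  smul_mem' := fun c f hf n hn => by
    have h : fourierCoeffLinear n (c • f) = c • fourierCoeff (f : Torus → E) n :=
      (fourierCoeffLinear (E := E) n).map_smul c f
    rw [hf n hn, smul_zero] at h
    exact h

theorem HTwo.isClosed : IsClosed (HTwo E : Set (LTwo E)) := by
  have : (HTwo E : Set (LTwo E)) =
      ⋂ n : ℤ, ⋂ _ : n < 0, {f : LTwo E | fourierCoeffCLM n f = 0} := by
    ext f
    simp only [Set.mem_iInter]
    exact Iff.rfl
  rw [this]
  exact isClosed_iInter fun n => isClosed_iInter fun _ =>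
    isClosed_eq (fourierCoeffCLM n).continuous continuous_const

instance HTwo.instCompleteSpace [CompleteSpace E] : CompleteSpace (HTwo E) :=
  (HTwo.isClosed E).completeSpace_coe

end Spaces

/-! ### Symbols, Laurent operators and Toeplitz operators -/

section Toeplitz

variable {E : Type u} [NormedAddCommGroup E] [InnerProductSpace ℂ E] [CompleteSpace E]

/-- `Φ` is an essentially bounded (strong-`*`) measurable function on the circle with values in the
bounded operators on `E`. For separable `E` this measurability is the usual weak one. -/
structure IsLInfty (Φ : Torus → E →L[ℂ] E) : Prop where
  measurable : ∀ x : E, AEStronglyMeasurable (fun t => Φ t x) leb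
  measurable_adjoint : ∀ x : E,
    AEStronglyMeasurable (fun t => ContinuousLinearMap.adjoint (Φ t) x) leb
  bounded : ∃ C : ℝ, ∀ᵐ t ∂leb, ‖Φ t‖ ≤ C

theorem IsLInfty.aestronglyMeasurable_apply {Φ : Torus → E →L[ℂ] E} (hΦ : IsLInfty Φ)
    {f : Torus → E} (hf : AEStronglyMeasurable f leb) :
    AEStronglyMeasurable (fun t => Φ t (f t)) leb := by
  obtain ⟨g, hg, hfg⟩ := hf
  have key : AEStronglyMeasurable (fun t => Φ t (g t)) leb := by
    refine aestronglyMeasurable_of_tendsto_ae (u := atTop)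
      (f := fun (n : ℕ) t => Φ t (hg.approx n t)) (fun n => ?_)
      (Eventually.of_forall fun t => ((Φ t).continuous.tendsto _).comp (hg.tendsto_approx t))
    have h : (fun t => Φ t (hg.approx n t)) = fun t => ∑ y ∈ (hg.approx n).range,
        ((hg.approx n) ⁻¹' {y}).indicator (fun t => Φ t y) t := by
      funext t
      rw [Finset.sum_eq_single (hg.approx n t)]
      · simp
      · intro b _ hb
        exact Set.indicator_of_notMem (fun h => hb (by simpa using h.symm)) _
      · intro h
        exact absurd (SimpleFunc.mem_range_self _ t) h
    rw [h]
    exact Finset.aestronglyMeasurable_fun_sum _ fun y _ =>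
      (hΦ.measurable y).indicator ((hg.approx n).measurableSet_fiber y)
  refine key.congr ?_
  filter_upwards [hfg] with t ht
  rw [ht]

theorem IsLInfty.memLp_apply {Φ : Torus → E →L[ℂ] E} (hΦ : IsLInfty Φ) (f : LTwo E) :
    MemLp (fun t => Φ t ((f : Torus → E) t)) 2 leb := by
  obtain ⟨C, hC⟩ := hΦ.bounded
  refine (Lp.memLp f).of_le_mul (c := C)
    (hΦ.aestronglyMeasurable_apply (Lp.aestronglyMeasurable f)) ?_
  filter_upwards [hC] with t ht
  exact (Φ t).le_of_opNorm_le ht _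

/-- The Laurent operator `f ↦ Φ f` on `L²`. -/
def laurent {Φ : Torus → E →L[ℂ] E} (hΦ : IsLInfty Φ) : LTwo E →L[ℂ] LTwo E :=
  LinearMap.mkContinuousOfExistsBound
    { toFun := fun f => (hΦ.memLp_apply f).toLp _
      map_add' := fun f g => by
        rw [← MemLp.toLp_add, MemLp.toLp_eq_toLp_iff]
        filter_upwards [Lp.coeFn_add f g] with t ht
        simp only [ht, Pi.add_apply, map_add]
      map_smul' := fun c f => by
        rw [RingHom.id_apply, ← MemLp.toLp_const_smul, MemLp.toLp_eq_toLp_iff]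
        filter_upwards [Lp.coeFn_smul c f] with t ht
        simp only [ht, Pi.smul_apply, map_smul] }
    (by
      obtain ⟨C, hC⟩ := hΦ.bounded
      refine ⟨C, fun f => Lp.norm_le_mul_norm_of_ae_le_mul ?_⟩
      filter_upwards [hC, (hΦ.memLp_apply f).coeFn_toLp] with t ht h2
      simp only [LinearMap.coe_mk, AddHom.coe_mk, h2]
      exact (Φ t).le_of_opNorm_le ht _)

theorem coeFn_laurent {Φ : Torus → E →L[ℂ] E} (hΦ : IsLInfty Φ) (f : LTwo E) :
    (laurent hΦ f : Torus → E) =ᵐ[leb] fun t => Φ t ((f : Torus → E) t) :=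
  (hΦ.memLp_apply f).coeFn_toLp

/-- The Toeplitz operator with symbol `Φ`: the compression to `H²` of the Laurent operator. -/
def toeplitz {Φ : Torus → E →L[ℂ] E} (hΦ : IsLInfty Φ) : HTwo E →L[ℂ] HTwo E :=
  (HTwo E).orthogonalProjectionOnto ∘L laurent hΦ ∘L (HTwo E).subtypeL

end Toeplitz

/-! ### Inner functions -/

section Inner

variable {E F : Type u} [NormedAddCommGroup E] [InnerProductSpace ℂ E]
  [NormedAddCommGroup F] [InnerProductSpace ℂ F]

/-- `Θ` is an operator-valued inner function on the unit disc with boundary function `Θb`: it is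
bounded and analytic on the disc, at almost every point of the circle `Θb` is its radial limit in
the strong operator topology, and `Θb` is isometric almost everywhere. -/
structure IsInner (Θ : ℂ → F →L[ℂ] E) (Θb : Torus → F →L[ℂ] E) : Prop where
  differentiableOn : DifferentiableOn ℂ Θ (Metric.ball 0 1)
  bounded : ∃ C : ℝ, ∀ z ∈ Metric.ball (0 : ℂ) 1, ‖Θ z‖ ≤ C
  boundary : ∀ᵐ t ∂leb, ∀ x : F,
    Tendsto (fun r : ℝ => Θ ((r : ℂ) * (toCircle t : ℂ)) x) (𝓝[<] 1) (𝓝 (Θb t x))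
  isometry : ∀ᵐ t ∂leb, ∀ x : F, ‖Θb t x‖ = ‖x‖

end Inner

end UnitaryToeplitz

end

/-!
# Toeplitz operators with a unitary part

*Complete non-unitarity of `T_Φ`.* Write `L` for the Laurent operator. It is bounded by the norm of
`T_Φ` (`norm_laurent_apply_le`), hence a contraction, and so it agrees with `T_Φ` on the unitary part
of `T_Φ`. The vectors of the unitary part of `L` whose orbit under `L` and `L*` stays in `H²` form a
closed shift-invariant subspace `N` of `H²`, which is therefore non-zero if `T_Φ` has a unitary part
(`coe_mem_unitaryPartIn`). The wandering subspace `N ⊖ zN` is non-zero (`exists_wandering`) and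
reduced by `L`, and each of its elements `f` satisfies `⟪zⁿ f, f⟫ = 0` for `n ≠ 0`, which says that
`‖f(z)‖` is constant on the circle (`ae_norm_eq_of_wandering`). Let `F` be the closed span of the
orbit of one wandering vector under `L` and `L*`. It is separable, so that evaluation of its elements
at `z` defines an inner function: Fatou's theorem (`ae_tendsto_poissonIntegral`) need only be applied
to countably many functions. This inner function intertwines `Φ(z)` and `Φ(z)*` with the unitary
operator `L|F` and its adjoint (`exists_inner_of_hasUnitaryPart`), contrary to (II). Its boundary
values embed `L|F` in almost every `Φ(z)` as a unitary part (`hasUnitaryPart_of_intertwining`),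
contrary to (I).

*Existence of `u(T)`.* Let `T` be any completely non-unitary contraction. By von Neumann's inequality
(`norm_tsum_smul_pow_le`, from a Poisson formula for operators) the `u(rT)` are contractions. Let `K`
be the closed subspace of the `x` for which `u(rT) x` is Cauchy as `r → 1-`. The Taylor coefficients
of `u` are square-summable, and so are the vectors `D Tⁿ x` for the defect operator `D` of `T`, as
`∑ ‖D Tⁿ x‖² ≤ ‖x‖²`. Applied to `T` and to `T*`, this shows that `K` contains the ranges of
`1 - T T*` and of `1 - T* T` and reduces `T`. Hence `T` is unitary on the complement of `K`, which
must vanish (`nullSubspace_radialDiff_eq_top`). No unitary dilation is needed.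

*Complete non-unitarity of `u(T)`.* By the Schwarz lemma, `(u - a) / (1 - ā u) = z w` with `a = u(0)`
and `|w| ≤ 1`. The corresponding identity for operators shows that `T` and `T*` are isometric on the
unitary part of `u(T)`, on which the Möbius transform of `u(T)` is isometric. As `T` commutes with
`u(T)`, it leaves this part invariant, so `T` would have a unitary part
(`isCNU_of_tendsto_radialCalculus`).
-/

noncomputable section

namespace UnitaryToeplitz

/-! ### The Poisson kernel and Fatou's theorem -/

/-- The Poisson kernel of the disc, `P_r(x) = (1 - r²) / |1 - r e^{2πix}|²`. -/
def poissonKernel (r : ℝ) (x : Torus) : ℝ := (1 - r ^ 2) / ‖1 - (r : ℂ) * toCircle x‖ ^ 2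

theorem one_sub_le_norm_one_sub_mul_toCircle {r : ℝ} (hr : 0 ≤ r) (x : Torus) :
    1 - r ≤ ‖1 - (r : ℂ) * toCircle x‖ := by
  have h := norm_sub_norm_le (1 : ℂ) ((r : ℂ) * toCircle x)
  simpa [abs_of_nonneg hr, Circle.norm_coe] using h

/-- Jordan's inequality `|sin x| ≥ 2 |x| / π`, as a lower bound for the chord by the arc. -/
theorem four_mul_norm_le_norm_one_sub_toCircle (x : Torus) :
    4 * ‖x‖ ≤ ‖1 - (toCircle x : ℂ)‖ := by
  obtain ⟨y, rfl⟩ : ∃ y : ℝ, (y : Torus) = x := QuotientAddGroup.mk_surjective x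
  -- replace `y` by its representative in `[-1/2, 1/2]`
  obtain ⟨y', hy', hyy'⟩ : ∃ y' : ℝ, |y'| ≤ 1 / 2 ∧ (y' : Torus) = y := by
    refine ⟨y - round y, abs_sub_round y, ?_⟩
    have : ((round y : ℝ) : Torus) = 0 := coe_eq_zero_iff (1 : ℝ) |>.2 ⟨round y, by simp⟩
    rw [coe_sub, this, sub_zero]
  rw [← hyy']
  have h1 : ‖(y' : Torus)‖ = |y'| := by
    rw [norm_coe_eq_abs_iff (1 : ℝ) one_ne_zero]; simpa using hy'
  rw [h1, toCircle_apply_mk, norm_sub_rev, Circle.coe_exp,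
    mul_comm _ Complex.I, Complex.norm_exp_I_mul_ofReal_sub_one]
  have h2 := Real.mul_abs_le_abs_sin (x := Real.pi * y') (by
    rw [abs_mul, abs_of_pos Real.pi_pos]
    nlinarith [Real.pi_pos])
  rw [abs_mul, abs_of_pos Real.pi_pos] at h2
  have h3 : 2 / Real.pi * (Real.pi * |y'|) = 2 * |y'| := by
    field_simp
  rw [h3] at h2
  rw [norm_mul, Real.norm_eq_abs, Real.norm_eq_abs, show 2 * Real.pi / 1 * y' / 2 = Real.pi * y' by ring]
  norm_num
  linarith

theorem two_mul_norm_le_norm_one_sub_mul_toCircle {r : ℝ} (hr : 0 ≤ r) (hr1 : r ≤ 1) (x : Torus) :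
    2 * ‖x‖ ≤ ‖1 - (r : ℂ) * toCircle x‖ := by
  have h1 := four_mul_norm_le_norm_one_sub_toCircle x
  have h2 := one_sub_le_norm_one_sub_mul_toCircle hr x
  have h3 : ‖(r : ℂ) * toCircle x - toCircle x‖ = 1 - r := by
    have : (r : ℂ) * toCircle x - toCircle x = ((r - 1 : ℝ) : ℂ) * toCircle x := by
      push_cast; ring
    rw [this, norm_mul, Circle.norm_coe, mul_one, Complex.norm_real, Real.norm_eq_abs,
      abs_of_nonpos (by linarith)]
    ring
  have h4 := norm_sub_le_norm_sub_add_norm_sub (1 : ℂ) ((r : ℂ) * toCircle x) (toCircle x)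
  linarith

theorem poissonKernel_nonneg {r : ℝ} (hr : 0 ≤ r) (hr1 : r < 1) (x : Torus) :
    0 ≤ poissonKernel r x :=
  div_nonneg (by nlinarith) (by positivity)

theorem continuous_poissonKernel {r : ℝ} (hr : 0 ≤ r) (hr1 : r < 1) :
    Continuous (poissonKernel r) := by
  refine Continuous.div continuous_const (by fun_prop) fun x => ?_
  have := one_sub_le_norm_one_sub_mul_toCircle hr x
  exact pow_ne_zero _ (by linarith)

theorem poissonKernel_le {r c : ℝ} (hr1 : r < 1) (hc : 0 < c) {x : Torus}
    (h : c ≤ ‖1 - (r : ℂ) * toCircle x‖) : poissonKernel r x ≤ 2 * (1 - r) / c ^ 2 := by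
  unfold poissonKernel
  gcongr
  nlinarith

/-- The Poisson kernel is dominated by one of the terms of the dyadic majorant
`∑ₖ 2 (1 - r)⁻¹ 4⁻ᵏ 1[‖x‖ ≤ 2ᵏ (1 - r)]`. -/
theorem exists_poissonKernel_le_dyadic {r : ℝ} (hr : 0 ≤ r) (hr1 : r < 1) (x : Torus) :
    ∃ k : ℕ, ‖x‖ ≤ 2 ^ k * (1 - r) ∧ poissonKernel r x ≤ 2 / (1 - r) * (1 / 4) ^ k := by
  have hh : 0 < 1 - r := by linarith
  have hex : ∃ k : ℕ, ‖x‖ ≤ 2 ^ k * (1 - r) := by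
    obtain ⟨k, hk⟩ := pow_unbounded_of_one_lt (‖x‖ / (1 - r)) (one_lt_two)
    exact ⟨k, by rw [div_lt_iff₀ hh] at hk; exact hk.le⟩
  classical
  refine ⟨Nat.find hex, Nat.find_spec hex, ?_⟩
  rcases hk : Nat.find hex with _ | k
  · refine (poissonKernel_le hr1 hh (one_sub_le_norm_one_sub_mul_toCircle hr x)).trans (le_of_eq ?_)
    field_simp
  · have h1 : 2 ^ k * (1 - r) < ‖x‖ := not_le.1 (Nat.find_min hex (m := k) (by omega))
    have h2 := two_mul_norm_le_norm_one_sub_mul_toCircle hr hr1.le x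
    refine (poissonKernel_le (c := 2 * (2 ^ k * (1 - r))) hr1 (by positivity)
      (by linarith)).trans (le_of_eq ?_)
    have : (1 / 4 : ℝ) ^ (k + 1) = 1 / (4 * (2 ^ k) ^ 2) := by
      rw [← pow_mul, mul_comm k 2, pow_mul, div_pow, one_pow, pow_succ]; norm_num [mul_comm]
    rw [this]
    field_simp
    norm_num

theorem summable_pow_natAbs {r : ℝ} (hr : 0 ≤ r) (hr1 : r < 1) :
    Summable fun n : ℤ => r ^ n.natAbs := by
  refine Summable.of_nat_of_neg ?_ ?_ <;> simpa using summable_geometric_of_lt_one hr hr1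

theorem hasSum_poissonKernel {r : ℝ} (hr : 0 ≤ r) (hr1 : r < 1) (x : Torus) :
    HasSum (fun n : ℤ => (r : ℂ) ^ n.natAbs * fourier n x) (poissonKernel r x : ℂ) := by
  set w : ℂ := (r : ℂ) * toCircle x with hw
  have hwn : ‖w‖ < 1 := by simpa [hw, abs_of_nonneg hr, Circle.norm_coe] using hr1
  have hwn' : ‖(starRingEnd ℂ) w‖ < 1 := by simpa using hwn
  have hf : ∀ n : ℕ, (fourier (n : ℤ) x : ℂ) = (toCircle x : ℂ) ^ n := fun n => by
    rw [fourier_apply, natCast_zsmul, toCircle_nsmul, Circle.coe_pow]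
  have h1 : HasSum (fun n : ℕ => (r : ℂ) ^ ((n : ℤ)).natAbs * fourier (n : ℤ) x) (1 - w)⁻¹ := by
    have e : (fun n : ℕ => (r : ℂ) ^ ((n : ℤ)).natAbs * fourier (n : ℤ) x) = fun n => w ^ n := by
      funext n
      rw [hf, Int.natAbs_natCast, hw, mul_pow]
    rw [e]
    exact hasSum_geometric_of_norm_lt_one hwn
  have h2 : HasSum (fun n : ℕ => (r : ℂ) ^ (-((n : ℤ) + 1)).natAbs * fourier (-((n : ℤ) + 1)) x)
      ((starRingEnd ℂ) w * (1 - (starRingEnd ℂ) w)⁻¹) := by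
    have e : (fun n : ℕ => (r : ℂ) ^ (-((n : ℤ) + 1)).natAbs * fourier (-((n : ℤ) + 1)) x) =
        fun n => (starRingEnd ℂ) w * (starRingEnd ℂ) w ^ n := by
      funext n
      rw [fourier_neg, ← Nat.cast_succ, hf, Int.natAbs_neg, Int.natAbs_natCast, ← pow_succ', hw,
        map_mul, map_pow, mul_pow, Complex.conj_ofReal]
    rw [e]
    exact (hasSum_geometric_of_norm_lt_one hwn').mul_left _
  suffices h3 : (poissonKernel r x : ℂ) =
      (1 - w)⁻¹ + (starRingEnd ℂ) w * (1 - (starRingEnd ℂ) w)⁻¹ by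
    rw [h3]
    exact HasSum.of_nat_of_neg_add_one h1 h2
  have n1 : (1 - w) ≠ 0 := fun h => by
    rw [sub_eq_zero] at h; rw [← h] at hwn; simp at hwn
  have n2 : (1 - (starRingEnd ℂ) w) ≠ 0 := fun h => by
    rw [sub_eq_zero] at h; rw [← h] at hwn'; simp at hwn'
  have e1 : ((‖1 - w‖ : ℂ)) ^ 2 = (1 - w) * (1 - (starRingEnd ℂ) w) := by
    rw [← Complex.mul_conj', map_sub, map_one]
  have e2 : (r : ℂ) ^ 2 = w * (starRingEnd ℂ) w := by
    rw [Complex.mul_conj', hw, norm_mul, Circle.norm_coe, Complex.norm_real, Real.norm_eq_abs,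
      abs_of_nonneg hr, mul_one]
  have e3 : (poissonKernel r x : ℂ) = (1 - (r : ℂ) ^ 2) / (‖1 - w‖ : ℂ) ^ 2 := by
    rw [poissonKernel]; push_cast; rfl
  rw [e3, e1, e2]
  generalize (starRingEnd ℂ) w = v at n2
  field_simp
  ring

/-- `t` is a Lebesgue point of `f`, expressed by the lower integral of `‖f - f t‖` over the balls
around `t`, since the ball of radius `s ≤ 1/2` has measure `2 s`. -/
def IsLebesguePoint {F : Type*} [NormedAddCommGroup F] (f : Torus → F) (t : Torus) : Prop :=
  ∀ ε : ℝ, 0 < ε → ∃ δ : ℝ, 0 < δ ∧ ∀ s : ℝ, 0 < s → s ≤ δ →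
    ∫⁻ y in Metric.closedBall t s, ‖f y - f t‖ₑ ∂leb ≤ ENNReal.ofReal (ε * s)

theorem volume_eq_leb : (volume : Measure Torus) = leb := by
  rw [volume_eq_smul_haarAddCircle]; simp

theorem ae_isLebesguePoint {F : Type*} [NormedAddCommGroup F] {f : Torus → F}
    (hf : Integrable f leb) :
    ∀ᵐ t ∂leb, IsLebesguePoint f t := by
  have hf' : Integrable f (volume : Measure Torus) := by rwa [volume_eq_leb]
  have h := IsUnifLocDoublingMeasure.ae_tendsto_average_norm_sub (volume : Measure Torus)
    hf'.locallyIntegrable 1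
  rw [← volume_eq_leb]
  filter_upwards [h] with t ht ε hε
  rw [← volume_eq_leb]
  have h1 := ht (l := 𝓝[>] (0 : ℝ)) (fun _ => t) id tendsto_id (by
    filter_upwards [self_mem_nhdsWithin] with s hs
    exact Metric.mem_closedBall_self (by simpa using (le_of_lt hs : (0 : ℝ) ≤ s)))
  have h2 := h1.eventually (gt_mem_nhds (half_pos hε))
  obtain ⟨δ, hδ, hsub⟩ := mem_nhdsGT_iff_exists_Ioc_subset.1 h2
  refine ⟨min δ (1 / 2), lt_min hδ (by norm_num), fun s hs hsδ => ?_⟩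
  have h3 : ⨍ y in Metric.closedBall t s, ‖f y - f t‖ < ε / 2 :=
    hsub ⟨hs, hsδ.trans (min_le_left _ _)⟩
  have hs2 : s ≤ 1 / 2 := hsδ.trans (min_le_right _ _)
  have hvol : (volume : Measure Torus).real (Metric.closedBall t s) = 2 * s := by
    rw [Measure.real, volume_closedBall, min_eq_right (by linarith),
      ENNReal.toReal_ofReal (by linarith)]
  rw [setAverage_eq, hvol, smul_eq_mul, inv_mul_lt_iff₀ (by linarith)] at h3
  have hint : Integrable (fun y => f y - f t) (volume.restrict (Metric.closedBall t s)) :=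
    (hf'.sub (integrable_const _)).restrict
  rw [← ofReal_integral_norm_eq_lintegral_enorm hint]
  exact ENNReal.ofReal_le_ofReal (by linarith)

section

variable {E : Type*} [NormedAddCommGroup E] [NormedSpace ℂ E]

theorem hasSum_poissonIntegral [CompleteSpace E] {f : Torus → E} (hf : Integrable f leb) {r : ℝ}
    (hr : 0 ≤ r) (hr1 : r < 1) (t : Torus) :
    HasSum (fun n : ℤ => ((r : ℂ) ^ n.natAbs * fourier n t) • fourierCoeff f n)
      (∫ s, (poissonKernel r (t - s) : ℂ) • f s ∂leb) := by
  have h := hasSum_integral_of_summable_integral_norm (μ := leb)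
    (F := fun (n : ℤ) s => ((r : ℂ) ^ n.natAbs * fourier n t) • (fourier (-n) s • f s))
    (fun n => (hf.fourier_smul (-n)).smul _) (by
      refine ((summable_pow_natAbs hr hr1).mul_right (∫ s, ‖f s‖ ∂leb)).congr fun n => ?_
      simp [norm_smul, abs_of_nonneg hr, integral_const_mul, Circle.norm_coe])
  convert h using 1
  · funext n
    rw [integral_smul, fourierCoeff]
  · refine integral_congr_ae (Eventually.of_forall fun s => ?_)
    have h1 := (hasSum_poissonKernel hr hr1 (t - s)).smul_const (f s)
    refine (h1.tsum_eq.symm.trans (tsum_congr fun n => ?_))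
    have : (fourier n (t - s) : ℂ) = fourier n t * fourier (-n) s := by
      simp only [fourier_apply]
      rw [smul_sub, sub_eq_add_neg, toCircle_add, Circle.coe_mul, neg_smul]
    rw [this, smul_smul, mul_assoc]

theorem integral_poissonKernel {r : ℝ} (hr : 0 ≤ r) (hr1 : r < 1) (t : Torus) :
    ∫ s, poissonKernel r (t - s) ∂leb = 1 := by
  have h := hasSum_poissonIntegral (f := fun _ : Torus => (1 : ℂ)) (integrable_const _) hr hr1 t
  have h0 : ∀ n : ℤ, fourierCoeff (fun _ : Torus => (1 : ℂ)) n = if n = 0 then 1 else 0 := by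
    intro n
    have := congrFun (fourierCoeff_fourier (T := 1) 0) n
    have h2 : ((fourier 0 : C(Torus, ℂ)) : Torus → ℂ) = fun _ => 1 := by
      funext x; exact fourier_zero
    rw [h2] at this
    rw [this, Pi.single_apply]
  have h1 : HasSum (fun n : ℤ => ((r : ℂ) ^ n.natAbs * fourier n t) •
      fourierCoeff (fun _ : Torus => (1 : ℂ)) n) 1 := by
    convert hasSum_ite_eq (0 : ℤ) (1 : ℂ) using 1
    funext n
    rw [h0]
    split_ifs with hn
    · subst hn; simp
    · simp
  have h3 := h.unique h1
  simp only [smul_eq_mul, mul_one] at h3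
  rw [integral_complex_ofReal] at h3
  exact_mod_cast h3

/-- Near a Lebesgue point, the part of the Poisson integral over a small ball is small, uniformly
in `r`: integrate the dyadic majorant of the Poisson kernel term by term. -/
theorem lintegral_closedBall_poissonKernel_le {g : Torus → ENNReal} (hg : AEMeasurable g leb)
    {t : Torus} {ε δ : ℝ}
    (hδ : ∀ s : ℝ, 0 < s → s ≤ δ → ∫⁻ y in Metric.closedBall t s, g y ∂leb ≤ ENNReal.ofReal (ε * s))
    (hδ0 : 0 < δ) (hε : 0 < ε) {r : ℝ} (hr : 0 ≤ r) (hr1 : r < 1) :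
    ∫⁻ y in Metric.closedBall t δ, ENNReal.ofReal (poissonKernel r (t - y)) * g y ∂leb ≤
      ENNReal.ofReal (4 * ε) := by
  have hh : 0 < 1 - r := by linarith
  set c : ℕ → ℝ := fun k => 2 / (1 - r) * (1 / 4) ^ k with hc
  set B : ℕ → Set Torus := fun k => Metric.closedBall t (2 ^ k * (1 - r)) with hB
  calc ∫⁻ y in Metric.closedBall t δ, ENNReal.ofReal (poissonKernel r (t - y)) * g y ∂leb
      ≤ ∫⁻ y in Metric.closedBall t δ, ∑' k, ENNReal.ofReal (c k) * (B k).indicator g y ∂leb := by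
        refine lintegral_mono fun y => ?_
        obtain ⟨k, hk1, hk2⟩ := exists_poissonKernel_le_dyadic hr hr1 (t - y)
        refine le_trans ?_ (ENNReal.le_tsum k)
        have hy : y ∈ B k := by
          rw [hB, Metric.mem_closedBall, dist_comm, dist_eq_norm]; exact hk1
        rw [Set.indicator_of_mem hy]
        gcongr
    _ = ∑' k, ∫⁻ y in Metric.closedBall t δ, ENNReal.ofReal (c k) * (B k).indicator g y ∂leb := by
        refine lintegral_tsum fun k => ?_
        exact ((hg.indicator Metric.isClosed_closedBall.measurableSet).const_mul _).restrict
    _ ≤ ∑' k : ℕ, ENNReal.ofReal (2 * ε * (1 / 2) ^ k) := by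
        refine ENNReal.tsum_le_tsum fun k => ?_
        rw [lintegral_const_mul' _ _ ENNReal.ofReal_ne_top,
          lintegral_indicator Metric.isClosed_closedBall.measurableSet,
          Measure.restrict_restrict Metric.isClosed_closedBall.measurableSet]
        have hs0 : 0 < min (2 ^ k * (1 - r)) δ := lt_min (by positivity) hδ0
        have h1 : ∫⁻ y in B k ∩ Metric.closedBall t δ, g y ∂leb ≤
            ENNReal.ofReal (ε * (2 ^ k * (1 - r))) := by
          refine (lintegral_mono_set ?_).trans ((hδ _ hs0 (min_le_right _ _)).trans ?_)
          · intro y hy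
            exact Metric.mem_closedBall.2
              (le_min (Metric.mem_closedBall.1 hy.1) (Metric.mem_closedBall.1 hy.2))
          · gcongr
            exact min_le_left _ _
        refine (mul_le_mul_right h1 _).trans ?_
        rw [← ENNReal.ofReal_mul (by positivity)]
        refine ENNReal.ofReal_le_ofReal (le_of_eq ?_)
        have h4 : (1 / 4 : ℝ) ^ k * 2 ^ k = (1 / 2) ^ k := by rw [← mul_pow]; norm_num
        rw [hc, ← h4]
        field_simp
    _ = ENNReal.ofReal (4 * ε) := by
        rw [← ENNReal.ofReal_tsum_of_nonneg (fun k => by positivity)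
          ((summable_geometric_of_lt_one (by norm_num) (by norm_num)).mul_left _), tsum_mul_left,
          tsum_geometric_of_lt_one (by norm_num) (by norm_num)]
        congr 1
        ring

theorem tendsto_poissonIntegral [CompleteSpace E] {f : Torus → E} (hf : Integrable f leb) {t : Torus}
    (ht : IsLebesguePoint f t) :
    Tendsto (fun r : ℝ => ∫ s, (poissonKernel r (t - s) : ℂ) • f s ∂leb) (𝓝[<] 1) (𝓝 (f t)) := by
  rw [tendsto_iff_edist_tendsto_0, ENNReal.tendsto_nhds_zero]
  intro η hη
  obtain ⟨ε, hε0, hε⟩ : ∃ ε : ℝ, 0 < ε ∧ ENNReal.ofReal (4 * ε) ≤ η / 2 := by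
    obtain ⟨ε, h1, h2⟩ := ENNReal.lt_iff_exists_nnreal_btwn.1 (ENNReal.half_pos hη.ne')
    refine ⟨ε / 4, by have : (0 : NNReal) < ε := by exact_mod_cast h1
                      positivity, ?_⟩
    rw [mul_div_cancel₀ _ (by norm_num), ENNReal.ofReal_coe_nnreal]
    exact h2.le
  obtain ⟨δ, hδ0, hδ⟩ := ht ε hε0
  set g : Torus → ENNReal := fun y => ‖f y - f t‖ₑ with hg
  have hint : Integrable (fun y => f y - f t) leb := hf.sub (integrable_const _)
  have hgm : AEMeasurable g leb := hint.aestronglyMeasurable.enorm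
  have hgfin : ∫⁻ y, g y ∂leb ≠ ⊤ := hint.2.ne
  -- the contribution of the complement of the ball tends to zero
  have hout : ∀ᶠ r : ℝ in 𝓝[<] 1,
      ENNReal.ofReal (2 * (1 - r) / (2 * δ) ^ 2) * ∫⁻ y, g y ∂leb ≤ η / 2 := by
    have h1 : Tendsto (fun r : ℝ => ENNReal.ofReal (2 * (1 - r) / (2 * δ) ^ 2) * ∫⁻ y, g y ∂leb)
        (𝓝[<] 1) (𝓝 (ENNReal.ofReal (2 * (1 - 1) / (2 * δ) ^ 2) * ∫⁻ y, g y ∂leb)) := by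
      refine ENNReal.Tendsto.mul_const ?_ (Or.inr hgfin)
      refine (ENNReal.continuous_ofReal.comp ?_).continuousAt.tendsto.mono_left nhdsWithin_le_nhds
      fun_prop
    have h2 : ENNReal.ofReal (2 * (1 - 1) / (2 * δ) ^ 2) * ∫⁻ y, g y ∂leb = 0 := by simp
    rw [h2] at h1
    exact ENNReal.tendsto_nhds_zero.1 h1 _ (ENNReal.half_pos hη.ne')
  filter_upwards [hout, Ioo_mem_nhdsLT (show (0 : ℝ) < 1 by norm_num)] with r hr1 ⟨hr0, hr⟩
  have hPc : Continuous fun s => (poissonKernel r (t - s) : ℂ) :=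
    Complex.continuous_ofReal.comp ((continuous_poissonKernel hr0.le hr).comp (by fun_prop))
  have hPi : ∀ h : Torus → E, Integrable h leb →
      Integrable (fun s => (poissonKernel r (t - s) : ℂ) • h s) leb := by
    intro h hh
    obtain ⟨C, hC⟩ := isCompact_univ.exists_bound_of_continuousOn hPc.continuousOn
    exact hh.bdd_smul C hPc.aestronglyMeasurable (Eventually.of_forall fun s => hC s (Set.mem_univ _))
  have hconst : f t = ∫ s, (poissonKernel r (t - s) : ℂ) • f t ∂leb := by
    rw [integral_smul_const, integral_complex_ofReal, integral_poissonKernel hr0.le hr]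
    simp
  rw [edist_eq_enorm_sub]
  conv_lhs => rw [hconst]
  rw [← integral_sub (hPi f hf) (hPi _ (integrable_const _))]
  refine (enorm_integral_le_lintegral_enorm _).trans ?_
  have h1 : ∀ y, ‖(poissonKernel r (t - y) : ℂ) • f y - (poissonKernel r (t - y) : ℂ) • f t‖ₑ =
      ENNReal.ofReal (poissonKernel r (t - y)) * g y := by
    intro y
    rw [← smul_sub, enorm_smul, hg, ← ofReal_norm, Complex.norm_real, Real.norm_eq_abs,
      abs_of_nonneg (poissonKernel_nonneg hr0.le hr _)]
  simp only [h1]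
  rw [← lintegral_add_compl _ (Metric.isClosed_closedBall (x := t) (ε := δ)).measurableSet,
    ← ENNReal.add_halves η]
  refine add_le_add ((lintegral_closedBall_poissonKernel_le hgm hδ hδ0 hε0 hr0.le hr).trans hε) ?_
  refine le_trans ?_ hr1
  rw [← lintegral_const_mul' _ _ ENNReal.ofReal_ne_top]
  refine (setLIntegral_mono' (Metric.isClosed_closedBall.measurableSet.compl) fun y hy => ?_).trans
    (setLIntegral_le_lintegral _ _)
  have hy' : δ < ‖t - y‖ := by
    rw [Set.mem_compl_iff, Metric.mem_closedBall, not_le, dist_comm, dist_eq_norm] at hy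
    exact hy
  gcongr
  refine poissonKernel_le hr (by positivity) ?_
  have := two_mul_norm_le_norm_one_sub_mul_toCircle hr0.le hr.le (t - y)
  linarith

/-- **Fatou's theorem** for vector-valued integrable functions: the Poisson integral has the radial
limit `f t` at almost every `t`. -/
theorem ae_tendsto_poissonIntegral [CompleteSpace E] {f : Torus → E} (hf : Integrable f leb) :
    ∀ᵐ t ∂leb, Tendsto (fun r : ℝ => ∫ s, (poissonKernel r (t - s) : ℂ) • f s ∂leb)
      (𝓝[<] 1) (𝓝 (f t)) := by
  filter_upwards [ae_isLebesguePoint hf] with t ht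
  exact tendsto_poissonIntegral hf ht

/-- An integrable function is determined by its Fourier coefficients. -/
theorem ae_eq_of_fourierCoeff_eq [CompleteSpace E] {f g : Torus → E} (hf : Integrable f leb)
    (hg : Integrable g leb) (h : ∀ n, fourierCoeff f n = fourierCoeff g n) : f =ᵐ[leb] g := by
  filter_upwards [ae_tendsto_poissonIntegral hf, ae_tendsto_poissonIntegral hg] with t h1 h2
  refine tendsto_nhds_unique h1 (h2.congr' ?_)
  filter_upwards [Ioo_mem_nhdsLT (show (0 : ℝ) < 1 by norm_num)] with r ⟨hr0, hr⟩
  refine (hasSum_poissonIntegral hg hr0.le hr t).unique ?_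
  simpa only [h] using hasSum_poissonIntegral hf hr0.le hr t

end

/-! ### Integrals of absolutely convergent exponential series -/

theorem integral_fourier (n : ℤ) : ∫ t, fourier n t ∂leb = if n = 0 then (1 : ℂ) else 0 := by
  have h := congrFun (fourierCoeff_fourier (T := 1) n) 0
  rw [fourierCoeff, Pi.single_apply] at h
  simpa [fourier_zero, eq_comm, -fourier_apply] using h

theorem norm_fourier_apply (n : ℤ) (t : Torus) : ‖(fourier n t : ℂ)‖ = 1 := by
  rw [fourier_apply, Circle.norm_coe]

section

variable {b : ℕ → ℂ}

theorem continuous_tsum_mul_fourier (hb : Summable fun n => ‖b n‖) (k : ℕ → ℤ) :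
    Continuous fun t : Torus => ∑' n, b n * fourier (k n) t := by
  refine continuous_tsum (fun n => by fun_prop) hb fun n t => ?_
  rw [norm_mul, norm_fourier_apply, mul_one]

theorem hasSum_integral_fourier_mul (hb : Summable fun n => ‖b n‖) (k : ℕ → ℤ) {f : Torus → ℂ}
    (hf : Continuous f) :
    HasSum (fun n => b n * ∫ t, fourier (k n) t * f t ∂leb)
      (∫ t, (∑' n, b n * fourier (k n) t) * f t ∂leb) := by
  have hfi : Integrable f leb := hf.integrable_of_hasCompactSupport
    (HasCompactSupport.of_compactSpace f)
  have h := hasSum_integral_of_summable_integral_norm (μ := leb)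
    (F := fun (n : ℕ) t => b n * (fourier (k n) t * f t))
    (fun n => (hfi.fourier_smul (k n)).const_mul _) (by
      refine (hb.mul_right (∫ s, ‖f s‖ ∂leb)).congr fun n => ?_
      simp only [norm_mul, norm_fourier_apply, one_mul, integral_const_mul])
  have e1 : ∀ t, (∑' n, b n * fourier (k n) t) * f t = ∑' n, b n * (fourier (k n) t * f t) := by
    intro t
    rw [← tsum_mul_right]
    simp only [mul_assoc]
  simp only [e1]
  simpa only [integral_const_mul] using h

theorem integral_tsum_mul_fourier (hb : Summable fun n => ‖b n‖) (m : ℕ) :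
    ∫ t, (∑' n, b n * fourier (n : ℤ) t) * fourier (-(m : ℤ)) t ∂leb = b m := by
  have h := hasSum_integral_fourier_mul hb (fun n => (n : ℤ)) (f := fun t => fourier (-(m : ℤ)) t)
    (by fun_prop)
  refine h.unique ?_
  simp only [← fourier_add, integral_fourier]
  convert hasSum_ite_eq m (b m) using 1
  funext n
  have : ((n : ℤ) + -(m : ℤ) = 0) ↔ n = m := by omega
  simp only [this]
  split_ifs with hn
  · rw [hn, mul_one]
  · rw [mul_zero]

theorem integral_tsum_mul_fourier_nonneg (hb : Summable fun n => ‖b n‖) (m : ℕ) :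
    ∫ t, (∑' n, b n * fourier (n : ℤ) t) * fourier (m : ℤ) t ∂leb = if m = 0 then b 0 else 0 := by
  have h := hasSum_integral_fourier_mul hb (fun n => (n : ℤ)) (f := fun t => fourier (m : ℤ) t)
    (by fun_prop)
  refine h.unique ?_
  simp only [← fourier_add, integral_fourier]
  convert hasSum_ite_eq 0 (if m = 0 then b 0 else 0) using 1
  funext n
  have : ((n : ℤ) + (m : ℤ) = 0) ↔ n = 0 ∧ m = 0 := by omega
  simp only [this]
  by_cases hn : n = 0 <;> by_cases hm : m = 0 <;> simp [hn, hm]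

/-- Parseval's identity for an absolutely convergent Taylor series on the circle. -/
theorem hasSum_norm_sq_integral (hb : Summable fun n => ‖b n‖) :
    HasSum (fun n => ‖b n‖ ^ 2) (∫ t, ‖∑' n, b n * fourier (n : ℤ) t‖ ^ 2 ∂leb) := by
  have hc := continuous_tsum_mul_fourier hb (fun n => (n : ℤ))
  have h := hasSum_integral_fourier_mul hb (fun n => (n : ℤ))
    (f := fun t => starRingEnd ℂ (∑' n, b n * fourier (n : ℤ) t)) (Complex.continuous_conj.comp hc)
  have e1 : ∀ n : ℕ, ∫ t, fourier (n : ℤ) t *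
      starRingEnd ℂ (∑' n, b n * fourier (n : ℤ) t) ∂leb = starRingEnd ℂ (b n) := by
    intro n
    rw [← integral_tsum_mul_fourier hb n, ← integral_conj]
    refine integral_congr_ae (Eventually.of_forall fun t => ?_)
    simp only [map_mul, fourier_neg, Complex.conj_conj]
    ring
  simp only [e1, Complex.mul_conj'] at h
  have h2 : ∫ t, (‖∑' n, b n * fourier (n : ℤ) t‖ : ℂ) ^ 2 ∂leb =
      ((∫ t, ‖∑' n, b n * fourier (n : ℤ) t‖ ^ 2 ∂leb : ℝ) : ℂ) := by
    rw [← integral_complex_ofReal]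
    simp only [Complex.ofReal_pow]
  rw [h2] at h
  exact_mod_cast h

end

/-! ### The von Neumann inequality -/

section VonNeumann

open ContinuousLinearMap

variable {H : Type*} [NormedAddCommGroup H] [InnerProductSpace ℂ H]

theorem norm_clm_pow_le (A : H →L[ℂ] H) (n : ℕ) : ‖A ^ n‖ ≤ ‖A‖ ^ n := by
  rcases n with _ | n
  · rw [pow_zero, pow_zero]
    exact ContinuousLinearMap.norm_id_le
  · exact norm_pow_le' A n.succ_pos

theorem summable_norm_inner_pow {A : H →L[ℂ] H} (hA : ‖A‖ < 1) (x y : H) :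
    Summable fun n : ℕ => ‖(inner ℂ y ((A ^ n) x) : ℂ)‖ := by
  refine Summable.of_nonneg_of_le (fun n => norm_nonneg _) (fun n => ?_)
    (((summable_geometric_of_lt_one (norm_nonneg A) hA).mul_left ‖y‖).mul_right ‖x‖)
  refine (norm_inner_le_norm _ _).trans ?_
  rw [mul_assoc]
  gcongr
  refine (le_opNorm _ _).trans ?_
  gcongr
  exact norm_clm_pow_le A n

variable [CompleteSpace H]

/-- A contraction has a defect operator `D`, with `D* D = 1 - T* T`. -/
theorem exists_defect {T : H →L[ℂ] H} (hT : ‖T‖ ≤ 1) :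
    ∃ D : H →L[ℂ] H, adjoint D * D = 1 - adjoint T * T := by
  have hpos : (0 : H →L[ℂ] H) ≤ 1 - adjoint T * T := by
    rw [nonneg_iff_isPositive, isPositive_def']
    refine ⟨?_, fun x => ?_⟩
    · rw [← star_eq_adjoint]
      exact (IsSelfAdjoint.one _).sub (IsSelfAdjoint.star_mul_self T)
    · have h : ‖T x‖ ≤ ‖x‖ := by simpa using T.le_of_opNorm_le hT x
      rw [reApplyInnerSelf, sub_apply, inner_sub_left, ContinuousLinearMap.mul_def, comp_apply, adjoint_inner_left, one_def,
        id_apply,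
        map_sub, inner_self_eq_norm_sq, inner_self_eq_norm_sq]
      nlinarith [norm_nonneg (T x)]
  refine ⟨CFC.sqrt (1 - adjoint T * T), ?_⟩
  have h1 : IsSelfAdjoint (CFC.sqrt (1 - adjoint T * T)) :=
    (CFC.sqrt_nonneg _).isSelfAdjoint
  rw [← star_eq_adjoint, h1.star_eq, CFC.sqrt_mul_sqrt_self _ hpos]

theorem inner_defect {T D : H →L[ℂ] H} (hD : adjoint D * D = 1 - adjoint T * T) (x y : H) :
    inner ℂ (D x) (D y) = inner ℂ x y - inner ℂ (T x) (T y) := by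
  rw [← adjoint_inner_right D, ← comp_apply, ← ContinuousLinearMap.mul_def, hD, sub_apply, one_def,
    id_apply, inner_sub_right, ContinuousLinearMap.mul_def, comp_apply, adjoint_inner_right]

theorem norm_defect_sq {T D : H →L[ℂ] H} (hD : adjoint D * D = 1 - adjoint T * T) (x : H) :
    ‖D x‖ ^ 2 = ‖x‖ ^ 2 - ‖T x‖ ^ 2 := by
  have h := inner_defect hD x x
  simp only [inner_self_eq_norm_sq_to_K] at h
  exact_mod_cast h

/-- The operator-valued Cauchy kernel `∑ₙ ζ⁻ⁿ Aⁿ = (1 - ζ⁻¹ A)⁻¹`, with `ζ = e^{2πit}`. -/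
def cauchyKernel (A : H →L[ℂ] H) (t : Torus) : H →L[ℂ] H :=
  ∑' n : ℕ, ((fourier (-1) t : ℂ) • A) ^ n

theorem norm_fourier_smul_lt {A : H →L[ℂ] H} (hA : ‖A‖ < 1) (n : ℤ) (t : Torus) :
    ‖(fourier n t : ℂ) • A‖ < 1 := by
  rwa [norm_smul, norm_fourier_apply, one_mul]

theorem fourier_neg_one_pow (t : Torus) (n : ℕ) : (fourier (-1) t : ℂ) ^ n = fourier (-(n : ℤ)) t := by
  induction n with
  | zero => simp [fourier_zero, -fourier_apply]
  | succ n ih => rw [pow_succ, ih, ← fourier_add]; congr 2; push_cast; ring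

theorem hasSum_cauchyKernel {A : H →L[ℂ] H} (hA : ‖A‖ < 1) (t : Torus) :
    HasSum (fun n : ℕ => (fourier (-(n : ℤ)) t : ℂ) • A ^ n) (cauchyKernel A t) := by
  have h := (summable_geometric_of_norm_lt_one (norm_fourier_smul_lt hA (-1) t)).hasSum
  simpa only [smul_pow, fourier_neg_one_pow, cauchyKernel] using h

theorem inner_cauchyKernel {A : H →L[ℂ] H} (hA : ‖A‖ < 1) (x y : H) (t : Torus) :
    inner ℂ y (cauchyKernel A t x) = ∑' n : ℕ, inner ℂ y ((A ^ n) x) * fourier (-(n : ℤ)) t := by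
  have h := ((hasSum_cauchyKernel hA t).mapL (ContinuousLinearMap.apply ℂ H x)).mapL
    (innerSL ℂ y)
  refine (h.tsum_eq.symm.trans (tsum_congr fun n => ?_))
  simp [mul_comm, -fourier_apply]

theorem inner_cauchyKernel_left {A : H →L[ℂ] H} (hA : ‖A‖ < 1) (x y : H) (t : Torus) :
    inner ℂ (cauchyKernel A t y) x = ∑' n : ℕ, inner ℂ ((A ^ n) y) x * fourier (n : ℤ) t := by
  rw [← inner_conj_symm, inner_cauchyKernel hA, RCLike.conj_tsum]
  refine tsum_congr fun n => ?_
  rw [map_mul, inner_conj_symm, fourier_neg, Complex.conj_conj]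

/-- Sandwiched between Cauchy kernels, `D* D` is the operator-valued Poisson kernel of `A`. -/
theorem inner_defect_cauchyKernel {A D : H →L[ℂ] H} (hA : ‖A‖ < 1)
    (hD : adjoint D * D = 1 - adjoint A * A) (x y : H) (t : Torus) :
    inner ℂ (D (cauchyKernel A t y)) (D (cauchyKernel A t x)) =
      inner ℂ y (cauchyKernel A t x) + inner ℂ (cauchyKernel A t y) x - inner ℂ y x := by
  have h : ∀ z, z = cauchyKernel A t z - (fourier (-1) t : ℂ) • A (cauchyKernel A t z) := fun z => by
    have := mul_neg_geom_series ((fourier (-1) t : ℂ) • A) (norm_fourier_smul_lt hA (-1) t)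
    have h2 := DFunLike.congr_fun this z
    simpa [cauchyKernel, -fourier_apply] using h2.symm
  rw [inner_defect hD]
  generalize hξ : cauchyKernel A t x = ξ
  generalize hη : cauchyKernel A t y = η
  have hx := h x
  have hy := h y
  rw [hξ] at hx
  rw [hη] at hy
  have hc : starRingEnd ℂ (fourier (-1) t : ℂ) * (fourier (-1) t : ℂ) = 1 := by
    rw [Complex.conj_mul', norm_fourier_apply]; simp
  rw [hx, hy]
  simp only [inner_sub_left, inner_sub_right, inner_smul_left, inner_smul_right]
  linear_combination (inner ℂ (A η) (A ξ)) * hc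

variable {a : ℕ → ℂ}

/-- The Poisson formula for operators: integrating a power series against the positive Poisson kernel
of `A` gives the power series in `A`. -/
theorem integral_mul_inner_defect_cauchyKernel {A D : H →L[ℂ] H} (hA : ‖A‖ < 1)
    (hD : adjoint D * D = 1 - adjoint A * A) (ha : Summable fun n => ‖a n‖) (x y : H) :
    ∫ t, (∑' n, a n * fourier (n : ℤ) t) *
      inner ℂ (D (cauchyKernel A t y)) (D (cauchyKernel A t x)) ∂leb =
        ∑' n, a n * inner ℂ y ((A ^ n) x) := by
  set q : Torus → ℂ := fun t => ∑' n, a n * fourier (n : ℤ) t with hq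
  have hqc : Continuous q := continuous_tsum_mul_fourier ha (fun n => (n : ℤ))
  have hi : ∀ {f : Torus → ℂ}, Continuous f → Integrable f leb := fun hf =>
    hf.integrable_of_hasCompactSupport (HasCompactSupport.of_compactSpace _)
  have hb1 := summable_norm_inner_pow hA x y
  have hb2 : Summable fun n : ℕ => ‖(inner ℂ ((A ^ n) y) x : ℂ)‖ := by
    refine (summable_norm_inner_pow hA y x).congr fun n => ?_
    rw [← inner_conj_symm, RCLike.norm_conj]
  have h1 := hasSum_integral_fourier_mul hb1 (fun n => -(n : ℤ)) hqc
  have h2 := hasSum_integral_fourier_mul hb2 (fun n => (n : ℤ)) hqc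
  have c1 := continuous_tsum_mul_fourier hb1 (fun n => -(n : ℤ))
  have c2 := continuous_tsum_mul_fourier hb2 (fun n => (n : ℤ))
  have e1 : ∀ n : ℕ, ∫ t, fourier (-(n : ℤ)) t * q t ∂leb = a n := fun n => by
    simp only [mul_comm _ (q _)]
    exact integral_tsum_mul_fourier ha n
  have e2 : ∀ n : ℕ, ∫ t, fourier (n : ℤ) t * q t ∂leb = if n = 0 then a 0 else 0 := fun n => by
    simp only [mul_comm _ (q _)]
    exact integral_tsum_mul_fourier_nonneg ha n
  have e3 : ∫ t, q t ∂leb = a 0 := by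
    have := e2 0
    simpa [fourier_zero, -fourier_apply] using this
  simp only [e1] at h1
  simp only [e2] at h2
  have h2' : HasSum (fun n : ℕ => (inner ℂ ((A ^ n) y) x : ℂ) * if n = 0 then a 0 else 0)
      (inner ℂ y x * a 0) := by
    convert hasSum_ite_eq 0 (inner ℂ y x * a 0) using 1
    funext n
    split_ifs with hn
    · subst hn; simp
    · simp
  simp only [inner_defect_cauchyKernel hA hD, inner_cauchyKernel hA, inner_cauchyKernel_left hA]
  simp only [mul_comm (∑' n, a n * (fourier (n : ℤ) _ : ℂ))]
  rw [show (fun t : Torus => ((∑' n : ℕ, inner ℂ y ((A ^ n) x) * (fourier (-(n : ℤ)) t : ℂ)) +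
      (∑' n : ℕ, inner ℂ ((A ^ n) y) x * (fourier (n : ℤ) t : ℂ)) - inner ℂ y x) *
      (∑' n, a n * (fourier (n : ℤ) t : ℂ))) =
      fun t => ((∑' n : ℕ, inner ℂ y ((A ^ n) x) * (fourier (-(n : ℤ)) t : ℂ)) * q t +
      (∑' n : ℕ, inner ℂ ((A ^ n) y) x * (fourier (n : ℤ) t : ℂ)) * q t) - inner ℂ y x * q t from
      funext fun t => by simp only [hq]; ring]
  have i1 : Integrable
      (fun t => (∑' n : ℕ, inner ℂ y ((A ^ n) x) * (fourier (-(n : ℤ)) t : ℂ)) * q t) leb :=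
    hi (c1.mul hqc)
  have i2 : Integrable
      (fun t => (∑' n : ℕ, inner ℂ ((A ^ n) y) x * (fourier (n : ℤ) t : ℂ)) * q t) leb :=
    hi (c2.mul hqc)
  have i3 : Integrable (fun t => inner ℂ y x * q t) leb := hi (continuous_const.mul hqc)
  rw [integral_sub (by exact i1.add i2) i3, integral_add i1 i2, integral_const_mul, e3, h2.unique h2',
    ← h1.tsum_eq, add_sub_cancel_right]
  simp only [mul_comm]

theorem integral_norm_defect_cauchyKernel_sq {A D : H →L[ℂ] H} (hA : ‖A‖ < 1)
    (hD : adjoint D * D = 1 - adjoint A * A) (x : H) :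
    ∫ t, ‖D (cauchyKernel A t x)‖ ^ 2 ∂leb = ‖x‖ ^ 2 := by
  have ha : Summable fun n : ℕ => ‖(if n = 0 then 1 else 0 : ℂ)‖ := by
    refine summable_of_ne_finset_zero (s := {0}) fun n hn => ?_
    have : n ≠ 0 := by simpa using hn
    simp [this]
  have h := integral_mul_inner_defect_cauchyKernel hA hD ha x x
  have h1 : ∀ f : ℕ → ℂ, ∑' n : ℕ, (if n = 0 then 1 else 0 : ℂ) * f n = f 0 := fun f => by
    rw [tsum_eq_single 0 (fun n hn => by simp [hn])]; simp
  simp only [h1, inner_self_eq_norm_sq_to_K] at h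
  simp only [Nat.cast_zero, fourier_zero, one_mul, pow_zero, one_def, id_apply,
    inner_self_eq_norm_sq_to_K] at h
  have h2 : ∫ t, ((‖D (cauchyKernel A t x)‖ : ℂ)) ^ 2 ∂leb =
      ((∫ t, ‖D (cauchyKernel A t x)‖ ^ 2 ∂leb : ℝ) : ℂ) := by
    rw [← integral_complex_ofReal]
    simp only [Complex.ofReal_pow]
  refine Complex.ofReal_injective (h2.symm.trans (h.trans ?_))
  push_cast
  rfl

theorem continuous_cauchyKernel {A : H →L[ℂ] H} (hA : ‖A‖ < 1) : Continuous (cauchyKernel A) := by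
  refine continuous_tsum (fun n => by fun_prop) (summable_geometric_of_lt_one (norm_nonneg A) hA)
    fun n t => ?_
  rw [smul_pow, norm_smul, norm_pow, norm_fourier_apply, one_pow, one_mul]
  exact norm_clm_pow_le A n

/-- **von Neumann's inequality** for an absolutely convergent power series and a strict
contraction: the Poisson formula and the Cauchy--Schwarz inequality under the integral. -/
theorem norm_tsum_smul_pow_le {A : H →L[ℂ] H} (hA : ‖A‖ < 1) (ha : Summable fun n => ‖a n‖)
    {C : ℝ} (hC : ∀ t : Torus, ‖∑' n, a n * (fourier (n : ℤ) t : ℂ)‖ ≤ C) :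
    ‖∑' n, a n • A ^ n‖ ≤ C := by
  obtain ⟨D, hD⟩ := exists_defect hA.le
  have hC0 : 0 ≤ C := (norm_nonneg _).trans (hC 0)
  have hsum : Summable fun n => a n • A ^ n := by
    refine Summable.of_norm_bounded ha fun n => ?_
    rw [norm_smul]
    refine mul_le_of_le_one_right (norm_nonneg _) ?_
    exact (norm_clm_pow_le A n).trans (pow_le_one₀ (norm_nonneg _) hA.le)
  have hcont : ∀ x, Continuous fun t => D (cauchyKernel A t x) := fun x =>
    D.continuous.comp ((continuous_cauchyKernel hA).clm_apply continuous_const)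
  have hi : ∀ x, Integrable (fun t => ‖D (cauchyKernel A t x)‖ ^ 2) leb := fun x =>
    ((hcont x).norm.pow 2).integrable_of_hasCompactSupport (HasCompactSupport.of_compactSpace _)
  have key : ∀ x y : H, ‖(inner ℂ y ((∑' n, a n • A ^ n) x) : ℂ)‖ ≤ C * ((‖x‖ ^ 2 + ‖y‖ ^ 2) / 2) := by
    intro x y
    have h1 : inner ℂ y ((∑' n, a n • A ^ n) x) = ∑' n, a n * inner ℂ y ((A ^ n) x) := by
      have h := (hsum.hasSum.mapL (ContinuousLinearMap.apply ℂ H x)).mapL (innerSL ℂ y)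
      refine (h.tsum_eq.symm.trans (tsum_congr fun n => ?_))
      simp
    rw [h1, ← integral_mul_inner_defect_cauchyKernel hA hD ha,
      ← integral_norm_defect_cauchyKernel_sq hA hD x, ← integral_norm_defect_cauchyKernel_sq hA hD y,
      ← integral_add (hi x) (hi y), ← integral_div, ← integral_const_mul]
    refine norm_integral_le_of_norm_le ((((hi x).add (hi y)).div_const 2).const_mul C)
      (Eventually.of_forall fun t => ?_)
    rw [norm_mul]
    refine mul_le_mul (hC t) ((norm_inner_le_norm _ _).trans ?_) (norm_nonneg _) hC0
    have := two_mul_le_add_sq ‖D (cauchyKernel A t x)‖ ‖D (cauchyKernel A t y)‖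
    linarith
  refine opNorm_le_bound _ hC0 fun x => ?_
  generalize (∑' n, a n • A ^ n) = B at key
  rcases eq_or_ne (B x) 0 with h0 | h0
  · rw [h0, norm_zero]; positivity
  rcases eq_or_ne x 0 with hx | hx
  · simp [hx]
  -- test against the multiple of `B x` that has the same norm as `x`
  have h := key x (((‖x‖ / ‖B x‖ : ℝ) : ℂ) • B x)
  have hBx : 0 < ‖B x‖ := norm_pos_iff.2 h0
  have hx' : 0 < ‖x‖ := norm_pos_iff.2 hx
  rw [inner_smul_left, norm_mul, RCLike.norm_conj, Complex.norm_real, norm_smul, Complex.norm_real,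
    Real.norm_eq_abs, abs_of_pos (div_pos hx' hBx), inner_self_eq_norm_sq_to_K, norm_pow,
    div_mul_cancel₀ _ hBx.ne'] at h
  simp only [Complex.coe_algebraMap, Complex.norm_real, norm_norm] at h
  have e : ‖x‖ / ‖B x‖ * ‖B x‖ ^ 2 = ‖x‖ * ‖B x‖ := by field_simp
  rw [e] at h
  have h2 : ‖x‖ * ‖B x‖ ≤ ‖x‖ * (C * ‖x‖) := by nlinarith
  exact le_of_mul_le_mul_left h2 hx'

end VonNeumann

/-! ### Strong limits of bounded families of operators -/

section StrongLimits

variable {ι V W : Type*} [NormedAddCommGroup V] [NormedSpace ℂ V] [NormedAddCommGroup W]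
  [NormedSpace ℂ W]

/-- The vectors along which a family of operators tends to zero. -/
def nullSubspace (G : ι → V →L[ℂ] W) (l : Filter ι) : Submodule ℂ V where
  carrier := {x | Tendsto (fun i => G i x) l (𝓝 0)}
  zero_mem' := by simp [tendsto_const_nhds]
  add_mem' := fun {x y} hx hy => by
    have h : Tendsto (fun i => G i x + G i y) l (𝓝 (0 + 0)) := Filter.Tendsto.add hx hy
    simpa only [Set.mem_ofPred_eq, map_add, add_zero] using h
  smul_mem' := fun c x hx => by
    have h : Tendsto (fun i => c • G i x) l (𝓝 (c • (0 : W))) := Filter.Tendsto.const_smul hx c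
    simpa only [Set.mem_ofPred_eq, map_smul, smul_zero] using h

theorem mem_nullSubspace {G : ι → V →L[ℂ] W} {l : Filter ι} {x : V} :
    x ∈ nullSubspace G l ↔ Tendsto (fun i => G i x) l (𝓝 0) := Iff.rfl

theorem isClosed_nullSubspace {G : ι → V →L[ℂ] W} {l : Filter ι} {C : ℝ}
    (hC : ∀ᶠ i in l, ‖G i‖ ≤ C) : IsClosed (nullSubspace G l : Set V) := by
  refine isClosed_of_closure_subset fun x hx => ?_
  rw [SetLike.mem_coe, mem_nullSubspace, Metric.tendsto_nhds]
  intro ε hε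
  obtain ⟨y, hy, hxy⟩ := Metric.mem_closure_iff.1 hx (ε / (2 * (|C| + 1))) (by positivity)
  have hy' := (Metric.tendsto_nhds.1 (mem_nullSubspace.1 hy)) (ε / 2) (by positivity)
  filter_upwards [hC, hy'] with i h1 h2
  rw [dist_zero_right] at h2 ⊢
  have h3 : ‖G i (x - y)‖ ≤ (|C| + 1) * (ε / (2 * (|C| + 1))) := by
    refine ((G i).le_opNorm _).trans (mul_le_mul (h1.trans ?_) ?_ (norm_nonneg _) (by positivity))
    · exact (le_abs_self C).trans (by linarith)
    · rw [← dist_eq_norm]; exact hxy.le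
  have h4 : (|C| + 1) * (ε / (2 * (|C| + 1))) = ε / 2 := by field_simp
  have h5 : G i x = G i (x - y) + G i y := by rw [map_sub, sub_add_cancel]
  rw [h5]
  linarith [norm_add_le (G i (x - y)) (G i y)]

/-- A family of operators that is strongly Cauchy along `l` has a bounded strong limit, by the uniform
boundedness principle. -/
theorem exists_clm_tendsto [CompleteSpace V] [CompleteSpace W] {l : Filter ι} [l.NeBot]
    [l.IsCountablyGenerated] {G : ι → V →L[ℂ] W}
    (h : nullSubspace (fun p : ι × ι => G p.1 - G p.2) (l ×ˢ l) = ⊤) :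
    ∃ A : V →L[ℂ] W, ∀ x, Tendsto (fun i => G i x) l (𝓝 (A x)) := by
  have h1 : ∀ x, ∃ y, Tendsto (fun i => G i x) l (𝓝 y) := fun x => by
    have hx : x ∈ nullSubspace (fun p : ι × ι => G p.1 - G p.2) (l ×ˢ l) := h ▸ Submodule.mem_top
    rw [mem_nullSubspace] at hx
    have hc : Cauchy (map (fun i => G i x) l) := by
      rw [cauchy_map_iff', tendsto_uniformity_iff_dist_tendsto_zero]
      simpa only [dist_eq_norm, sub_apply] using
        tendsto_zero_iff_norm_tendsto_zero.1 hx
    exact cauchy_map_iff_exists_tendsto.1 hc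
  choose f hf using h1
  exact ⟨continuousLinearMapOfTendsto G (tendsto_pi_nhds.2 hf), hf⟩

theorem norm_le_of_tendsto {l : Filter ι} [l.NeBot] {G : ι → V →L[ℂ] W} {A : V →L[ℂ] W}
    (h : ∀ x, Tendsto (fun i => G i x) l (𝓝 (A x))) {C : ℝ} (hC0 : 0 ≤ C)
    (hC : ∀ᶠ i in l, ‖G i‖ ≤ C) : ‖A‖ ≤ C := by
  refine A.opNorm_le_bound hC0 fun x => ?_
  refine le_of_tendsto (h x).norm ?_
  filter_upwards [hC] with i hi
  exact (G i).le_of_opNorm_le hi x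

theorem tendsto_mul_apply {l : Filter ι} {F G : ι → V →L[ℂ] V} {A B : V →L[ℂ] V}
    (hF : ∀ x, Tendsto (fun i => F i x) l (𝓝 (A x))) (hG : ∀ x, Tendsto (fun i => G i x) l (𝓝 (B x)))
    {C : ℝ} (hC : ∀ᶠ i in l, ‖F i‖ ≤ C) (x : V) :
    Tendsto (fun i => (F i * G i) x) l (𝓝 ((A * B) x)) := by
  have h1 : Tendsto (fun i => F i (G i x - B x)) l (𝓝 0) := by
    refine squeeze_zero_norm' (a := fun i => C * ‖G i x - B x‖) ?_ ?_
    · filter_upwards [hC] with i hi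
      exact (F i).le_of_opNorm_le hi _
    · simpa using (tendsto_iff_norm_sub_tendsto_zero.1 (hG x)).const_mul C
  have h2 := h1.add (hF (B x))
  simpa using h2

end StrongLimits

/-! ### Power series in a contraction -/

section PowerSeries

open Metric

variable {f g : ℂ → ℂ}

theorem hasSum_taylorCoeff (hf : DifferentiableOn ℂ f (ball 0 1)) {z : ℂ} (hz : z ∈ ball (0 : ℂ) 1) :
    HasSum (fun n => taylorCoeff f n * z ^ n) (f z) := by
  have h := Complex.hasSum_taylorSeries_on_ball hf hz
  have e : (fun n => taylorCoeff f n * z ^ n) =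
      fun n : ℕ => (n.factorial : ℂ)⁻¹ • (z - 0) ^ n • iteratedDeriv n f 0 := by
    funext n
    simp only [taylorCoeff, sub_zero, smul_eq_mul]
    ring
  rwa [e]

theorem ofReal_mem_ball {r : ℝ} (hr : 0 ≤ r) (hr1 : r < 1) : (r : ℂ) ∈ ball (0 : ℂ) 1 := by
  simpa [abs_of_nonneg hr] using hr1

theorem mul_toCircle_mem_ball {r : ℝ} (hr : 0 ≤ r) (hr1 : r < 1) (t : Torus) :
    (r : ℂ) * toCircle t ∈ ball (0 : ℂ) 1 := by
  rw [mem_ball_zero_iff, norm_mul, Circle.norm_coe, mul_one, Complex.norm_real, Real.norm_eq_abs,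
    abs_of_nonneg hr]
  exact hr1

theorem summable_norm_taylorCoeff (hf : DifferentiableOn ℂ f (ball 0 1)) {r : ℝ} (hr : 0 ≤ r)
    (hr1 : r < 1) : Summable fun n => ‖taylorCoeff f n * (r : ℂ) ^ n‖ :=
  (hasSum_taylorCoeff hf (ofReal_mem_ball hr hr1)).summable.norm

theorem coe_fourier_natCast (n : ℕ) (t : Torus) :
    (fourier (n : ℤ) t : ℂ) = (toCircle t : ℂ) ^ n := by
  rw [fourier_apply, natCast_zsmul, toCircle_nsmul, Circle.coe_pow]

theorem tsum_taylorCoeff_fourier (hf : DifferentiableOn ℂ f (ball 0 1)) {r : ℝ} (hr : 0 ≤ r)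
    (hr1 : r < 1) (t : Torus) :
    ∑' n : ℕ, taylorCoeff f n * (r : ℂ) ^ n * (fourier (n : ℤ) t : ℂ) = f ((r : ℂ) * toCircle t) := by
  rw [← (hasSum_taylorCoeff hf (mul_toCircle_mem_ball hr hr1 t)).tsum_eq]
  refine tsum_congr fun n => ?_
  rw [coe_fourier_natCast, mul_pow, mul_assoc]

/-- Parseval's identity on the circles of radius `r`, as `r → 1-`. -/
theorem sum_norm_taylorCoeff_sq_le (hf : DifferentiableOn ℂ f (ball 0 1))
    (hf1 : ∀ z ∈ ball (0 : ℂ) 1, ‖f z‖ ≤ 1) (N : ℕ) :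
    ∑ n ∈ Finset.range N, ‖taylorCoeff f n‖ ^ 2 ≤ 1 := by
  have h1 : ∀ᶠ r : ℝ in 𝓝[<] 1, ∑ n ∈ Finset.range N, (‖taylorCoeff f n‖ * r ^ n) ^ 2 ≤ 1 := by
    filter_upwards [Ioo_mem_nhdsLT (show (0 : ℝ) < 1 by norm_num)] with r ⟨hr0, hr⟩
    have h := hasSum_norm_sq_integral (summable_norm_taylorCoeff hf hr0.le hr)
    have h2 : ∫ t : Torus, ‖∑' n : ℕ, taylorCoeff f n * (r : ℂ) ^ n * (fourier (n : ℤ) t : ℂ)‖ ^ 2 ∂leb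
        ≤ 1 := by
      have h3 := norm_integral_le_of_norm_le (μ := leb) (f := fun t : Torus =>
        ‖∑' n : ℕ, taylorCoeff f n * (r : ℂ) ^ n * (fourier (n : ℤ) t : ℂ)‖ ^ 2)
        (g := fun _ => 1) (integrable_const _) (Eventually.of_forall fun t => by
          rw [tsum_taylorCoeff_fourier hf hr0.le hr, norm_pow, norm_norm]
          exact pow_le_one₀ (norm_nonneg _) (hf1 _ (mul_toCircle_mem_ball hr0.le hr t)))
      refine (le_abs_self _).trans (h3.trans ?_)
      simp
    refine le_trans (le_of_eq ?_) ((sum_le_hasSum (Finset.range N) (fun n _ => by positivity) h).trans h2)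
    refine Finset.sum_congr rfl fun n _ => ?_
    rw [norm_mul, norm_pow, Complex.norm_real, Real.norm_eq_abs, abs_of_pos hr0]
  have h2 : Tendsto (fun r : ℝ => ∑ n ∈ Finset.range N, (‖taylorCoeff f n‖ * r ^ n) ^ 2) (𝓝[<] 1)
      (𝓝 (∑ n ∈ Finset.range N, (‖taylorCoeff f n‖ * 1 ^ n) ^ 2)) := by
    refine Tendsto.mono_left (Continuous.tendsto ?_ 1) nhdsWithin_le_nhds
    fun_prop
  simpa using le_of_tendsto h2 h1

theorem summable_norm_taylorCoeff_sq (hf : DifferentiableOn ℂ f (ball 0 1))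
    (hf1 : ∀ z ∈ ball (0 : ℂ) 1, ‖f z‖ ≤ 1) : Summable fun n => ‖taylorCoeff f n‖ ^ 2 :=
  summable_of_sum_range_le (fun n => by positivity) (sum_norm_taylorCoeff_sq_le hf hf1)

variable {H : Type*} [NormedAddCommGroup H] [InnerProductSpace ℂ H]

/-- The operator `f(rT)`, as the sum of the power series `∑ aₙ rⁿ Tⁿ`. -/
def radialCalculus (f : ℂ → ℂ) (T : H →L[ℂ] H) (r : ℝ) : H →L[ℂ] H :=
  ∑' n : ℕ, (taylorCoeff f n * (r : ℂ) ^ n) • T ^ n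

theorem norm_clm_pow_le_one {T : H →L[ℂ] H} (hT : ‖T‖ ≤ 1) (n : ℕ) : ‖T ^ n‖ ≤ 1 :=
  (norm_clm_pow_le T n).trans (pow_le_one₀ (norm_nonneg _) hT)

theorem summable_norm_radialCalculus (hf : DifferentiableOn ℂ f (ball 0 1)) {T : H →L[ℂ] H}
    (hT : ‖T‖ ≤ 1) {r : ℝ} (hr : 0 ≤ r) (hr1 : r < 1) :
    Summable fun n => ‖(taylorCoeff f n * (r : ℂ) ^ n) • T ^ n‖ := by
  refine Summable.of_nonneg_of_le (fun n => norm_nonneg _) (fun n => ?_)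
    (summable_norm_taylorCoeff hf hr hr1)
  rw [norm_smul]
  exact mul_le_of_le_one_right (norm_nonneg _) (norm_clm_pow_le_one hT n)

theorem radialCalculus_const (c : ℂ) (T : H →L[ℂ] H) (r : ℝ) :
    radialCalculus (fun _ => c) T r = c • 1 := by
  rw [radialCalculus, tsum_eq_single 0]
  · simp [taylorCoeff]
  · intro n hn
    simp [taylorCoeff, iteratedDeriv_const, hn]

theorem radialCalculus_id (T : H →L[ℂ] H) (r : ℝ) : radialCalculus id T r = (r : ℂ) • T := by
  rw [radialCalculus, tsum_eq_single 1]
  · simp [taylorCoeff]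
  · intro n hn
    rcases n with _ | _ | n
    · simp [taylorCoeff]
    · exact absurd rfl hn
    · simp [taylorCoeff, iteratedDeriv_id]

variable [CompleteSpace H] {T : H →L[ℂ] H}

theorem hasSum_radialCalculus (hf : DifferentiableOn ℂ f (ball 0 1))
    (hT : ‖T‖ ≤ 1) {r : ℝ} (hr : 0 ≤ r) (hr1 : r < 1) :
    HasSum (fun n => (taylorCoeff f n * (r : ℂ) ^ n) • T ^ n) (radialCalculus f T r) :=
  (summable_norm_radialCalculus hf hT hr hr1).of_norm.hasSum

/-- **von Neumann's inequality** for `f(rT)`. -/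
theorem norm_radialCalculus_le (hf : DifferentiableOn ℂ f (ball 0 1)) {C : ℝ}
    (hfC : ∀ z ∈ ball (0 : ℂ) 1, ‖f z‖ ≤ C) (hT : ‖T‖ ≤ 1) {r : ℝ} (hr : 0 ≤ r) (hr1 : r < 1) :
    ‖radialCalculus f T r‖ ≤ C := by
  -- distribute `r = √r √r` over the coefficients and the operator
  set ρ := √r with hρ
  have hρ0 : 0 ≤ ρ := Real.sqrt_nonneg r
  have hρ1 : ρ < 1 := by rw [hρ, Real.sqrt_lt' one_pos]; simpa using hr1
  have hρr : (r : ℂ) = ρ * ρ := by rw [← Complex.ofReal_mul, hρ, Real.mul_self_sqrt hr]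
  have h1 : radialCalculus f T r = ∑' n, (taylorCoeff f n * (ρ : ℂ) ^ n) • ((ρ : ℂ) • T) ^ n := by
    refine tsum_congr fun n => ?_
    rw [smul_pow, smul_smul, hρr, mul_pow, mul_assoc]
  rw [h1]
  refine norm_tsum_smul_pow_le ?_ (summable_norm_taylorCoeff hf hρ0 hρ1) fun t => ?_
  · rw [norm_smul, Complex.norm_real, Real.norm_eq_abs, abs_of_nonneg hρ0]
    nlinarith [norm_nonneg T]
  · rw [tsum_taylorCoeff_fourier hf hρ0 hρ1]
    exact hfC _ (mul_toCircle_mem_ball hρ0 hρ1 t)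

theorem commute_radialCalculus {S : H →L[ℂ] H} (h : Commute S T) (f : ℂ → ℂ) (r : ℝ) :
    Commute S (radialCalculus f T r) :=
  Commute.tsum_right _ fun n => (h.pow_right n).smul_right _

theorem contDiffAt_of_differentiableOn_ball (hf : DifferentiableOn ℂ f (ball 0 1)) (n : ℕ) :
    ContDiffAt ℂ n f 0 :=
  (hf.analyticAt (ball_mem_nhds 0 one_pos)).contDiffAt

theorem taylorCoeff_congr (h : Set.EqOn f g (ball 0 1)) (n : ℕ) :
    taylorCoeff f n = taylorCoeff g n := by
  have : f =ᶠ[𝓝 0] g := h.eventuallyEq_of_mem (ball_mem_nhds 0 one_pos)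
  rw [taylorCoeff, taylorCoeff, this.iteratedDeriv_eq]

theorem taylorCoeff_mul (hf : DifferentiableOn ℂ f (ball 0 1)) (hg : DifferentiableOn ℂ g (ball 0 1))
    (n : ℕ) : taylorCoeff (f * g) n =
      ∑ k ∈ Finset.range (n + 1), taylorCoeff f k * taylorCoeff g (n - k) := by
  rw [taylorCoeff, iteratedDeriv_mul (contDiffAt_of_differentiableOn_ball hf n)
    (contDiffAt_of_differentiableOn_ball hg n), Finset.sum_div]
  refine Finset.sum_congr rfl fun k hk => ?_
  have hk' : k ≤ n := Nat.lt_succ_iff.1 (Finset.mem_range.1 hk)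
  rw [taylorCoeff, taylorCoeff, Nat.cast_choose ℂ hk']
  have h1 := (Nat.cast_ne_zero (R := ℂ)).2 n.factorial_ne_zero
  field_simp

theorem radialCalculus_mul (hf : DifferentiableOn ℂ f (ball 0 1))
    (hg : DifferentiableOn ℂ g (ball 0 1)) (hT : ‖T‖ ≤ 1) {r : ℝ} (hr : 0 ≤ r) (hr1 : r < 1) :
    radialCalculus (f * g) T r = radialCalculus f T r * radialCalculus g T r := by
  rw [radialCalculus, radialCalculus, radialCalculus,
    tsum_mul_tsum_eq_tsum_sum_range_of_summable_norm (summable_norm_radialCalculus hf hT hr hr1)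
      (summable_norm_radialCalculus hg hT hr hr1)]
  refine tsum_congr fun n => ?_
  rw [taylorCoeff_mul hf hg, Finset.sum_mul, Finset.sum_smul]
  refine Finset.sum_congr rfl fun k hk => ?_
  have hk' : k ≤ n := Nat.lt_succ_iff.1 (Finset.mem_range.1 hk)
  rw [smul_mul_smul_comm, ← pow_add, Nat.add_sub_cancel' hk']
  congr 1
  rw [← Nat.add_sub_cancel' hk', pow_add, Nat.add_sub_cancel' hk']
  ring

theorem radialCalculus_sub (hf : DifferentiableOn ℂ f (ball 0 1))
    (hg : DifferentiableOn ℂ g (ball 0 1)) (hT : ‖T‖ ≤ 1) {r : ℝ} (hr : 0 ≤ r) (hr1 : r < 1) :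
    radialCalculus (f - g) T r = radialCalculus f T r - radialCalculus g T r := by
  rw [radialCalculus, radialCalculus, radialCalculus,
    ← (hasSum_radialCalculus hf hT hr hr1).summable.tsum_sub
    (hasSum_radialCalculus hg hT hr hr1).summable]
  refine tsum_congr fun n => ?_
  rw [← sub_smul, ← sub_mul, taylorCoeff, taylorCoeff, taylorCoeff,
    iteratedDeriv_sub (contDiffAt_of_differentiableOn_ball hf n)
    (contDiffAt_of_differentiableOn_ball hg n), sub_div]

end PowerSeries

/-! ### Existence of the functional calculus -/

section Existence

open Metric ContinuousLinearMap

theorem tendsto_of_sq_le {ι V : Type*} [NormedAddCommGroup V] {l : Filter ι} {v : ι → V}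
    {a : ι → ℝ} {C : ℝ}
    (ha : Tendsto a l (𝓝 0)) (h : ∀ᶠ i in l, ‖v i‖ ^ 2 ≤ a i * C) : Tendsto v l (𝓝 0) := by
  have h1 : Tendsto (fun i => ‖v i‖ ^ 2) l (𝓝 0) := by
    refine squeeze_zero' (Eventually.of_forall fun i => by positivity) h ?_
    simpa using ha.mul_const C
  have h2 := h1.sqrt
  simp only [Real.sqrt_sq (norm_nonneg _), Real.sqrt_zero] at h2
  exact tendsto_zero_iff_norm_tendsto_zero.2 h2

variable {H : Type*} [NormedAddCommGroup H] [InnerProductSpace ℂ H] [CompleteSpace H]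
  {T D : H →L[ℂ] H}

theorem sum_norm_defect_pow_sq_le (hD : adjoint D * D = 1 - adjoint T * T) (x : H) (N : ℕ) :
    ∑ n ∈ Finset.range N, ‖D ((T ^ n) x)‖ ^ 2 ≤ ‖x‖ ^ 2 := by
  have h : ∑ n ∈ Finset.range N, ‖D ((T ^ n) x)‖ ^ 2 = ‖x‖ ^ 2 - ‖(T ^ N) x‖ ^ 2 := by
    induction N with
    | zero => simp
    | succ N ih =>
      rw [Finset.sum_range_succ, ih, norm_defect_sq hD, pow_succ' T, ContinuousLinearMap.mul_def,
        comp_apply]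
      ring
  rw [h]
  nlinarith [norm_nonneg ((T ^ N) x)]

/-- A power series in `T`, followed by the defect operator of `T`, is controlled by the `ℓ²` norm
of the coefficients: this is the Cauchy--Schwarz inequality, since `∑ ‖D Tⁿ x‖² ≤ ‖x‖²`. -/
theorem norm_defect_tsum_smul_pow_sq_le (hD : adjoint D * D = 1 - adjoint T * T) {c : ℕ → ℂ}
    (hc : Summable fun n => c n • T ^ n) (hc2 : Summable fun n => ‖c n‖ ^ 2) (x : H) :
    ‖D ((∑' n, c n • T ^ n) x)‖ ^ 2 ≤ (∑' n, ‖c n‖ ^ 2) * ‖x‖ ^ 2 := by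
  have h1 : HasSum (fun n => c n • D ((T ^ n) x)) (D ((∑' n, c n • T ^ n) x)) := by
    have h := (hc.hasSum.mapL (ContinuousLinearMap.apply ℂ H x)).mapL D
    simpa using h
  refine le_of_tendsto (h1.tendsto_sum_nat.norm.pow 2) (Eventually.of_forall fun N => ?_)
  calc ‖∑ n ∈ Finset.range N, c n • D ((T ^ n) x)‖ ^ 2
      ≤ (∑ n ∈ Finset.range N, ‖c n‖ * ‖D ((T ^ n) x)‖) ^ 2 := by
        gcongr
        exact (norm_sum_le _ _).trans (le_of_eq (by simp only [norm_smul]))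
    _ ≤ (∑ n ∈ Finset.range N, ‖c n‖ ^ 2) * ∑ n ∈ Finset.range N, ‖D ((T ^ n) x)‖ ^ 2 :=
        Finset.sum_mul_sq_le_sq_mul_sq _ _ _
    _ ≤ (∑' n, ‖c n‖ ^ 2) * ‖x‖ ^ 2 := by
        gcongr
        · exact hc2.sum_le_tsum _ fun n _ => by positivity
        · exact sum_norm_defect_pow_sq_le hD x N

variable {f : ℂ → ℂ}

/-- The pairs `(r, s)` with `r, s → 1-`. -/
abbrev radialPairs : Filter (ℝ × ℝ) := 𝓝[<] 1 ×ˢ 𝓝[<] 1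

theorem eventually_radialPairs :
    ∀ᶠ p : ℝ × ℝ in radialPairs, (0 ≤ p.1 ∧ p.1 < 1) ∧ 0 ≤ p.2 ∧ p.2 < 1 := by
  have h : ∀ᶠ r : ℝ in 𝓝[<] 1, 0 ≤ r ∧ r < 1 := by
    filter_upwards [Ioo_mem_nhdsLT (show (0 : ℝ) < 1 by norm_num)] with r hr
    exact ⟨hr.1.le, hr.2⟩
  exact h.prod_mk h

theorem tendsto_tsum_coeff_sub_sq (hf : DifferentiableOn ℂ f (ball 0 1))
    (hf1 : ∀ z ∈ ball (0 : ℂ) 1, ‖f z‖ ≤ 1) :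
    Tendsto (fun p : ℝ × ℝ => ∑' n : ℕ, ‖taylorCoeff f n * ((p.1 : ℂ) ^ n - (p.2 : ℂ) ^ n)‖ ^ 2)
      radialPairs (𝓝 0) := by
  have h := tendsto_tsum_of_dominated_convergence (𝓕 := radialPairs)
    (f := fun (p : ℝ × ℝ) (n : ℕ) => ‖taylorCoeff f n * ((p.1 : ℂ) ^ n - (p.2 : ℂ) ^ n)‖ ^ 2)
    (g := fun _ => 0) ((summable_norm_taylorCoeff_sq hf hf1).mul_left 4) (fun n => ?_) ?_
  · simpa using h
  · have h1 : Tendsto (fun p : ℝ × ℝ => ‖taylorCoeff f n * ((p.1 : ℂ) ^ n - (p.2 : ℂ) ^ n)‖ ^ 2)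
        (𝓝 ((1 : ℝ), (1 : ℝ))) (𝓝 (‖taylorCoeff f n * (((1 : ℝ) : ℂ) ^ n - ((1 : ℝ) : ℂ) ^ n)‖ ^ 2)) :=
      Continuous.tendsto (f := fun p : ℝ × ℝ =>
        ‖taylorCoeff f n * ((p.1 : ℂ) ^ n - (p.2 : ℂ) ^ n)‖ ^ 2) (by fun_prop) ((1 : ℝ), (1 : ℝ))
    rw [sub_self, mul_zero, norm_zero, zero_pow two_ne_zero, nhds_prod_eq] at h1
    exact h1.mono_left (Filter.prod_mono nhdsWithin_le_nhds nhdsWithin_le_nhds)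
  · filter_upwards [eventually_radialPairs] with p ⟨h1, h2⟩ n
    have hb : ∀ r : ℝ, 0 ≤ r ∧ r < 1 → ‖(r : ℂ) ^ n‖ ≤ 1 := fun r hr => by
      rw [norm_pow, Complex.norm_real, Real.norm_eq_abs, abs_of_nonneg hr.1]
      exact pow_le_one₀ hr.1 hr.2.le
    have h3 : ‖(p.1 : ℂ) ^ n - (p.2 : ℂ) ^ n‖ ≤ 2 :=
      (norm_sub_le _ _).trans (by linarith [hb _ h1, hb _ h2])
    rw [norm_pow, norm_norm, norm_mul, mul_pow, mul_comm]
    gcongr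
    nlinarith [norm_nonneg ((p.1 : ℂ) ^ n - (p.2 : ℂ) ^ n)]

/-- The difference of the operators `f(rT)` and `f(sT)`. -/
def radialDiff (f : ℂ → ℂ) (T : H →L[ℂ] H) (p : ℝ × ℝ) : H →L[ℂ] H :=
  radialCalculus f T p.1 - radialCalculus f T p.2

theorem hasSum_radialDiff (hf : DifferentiableOn ℂ f (ball 0 1)) (hT : ‖T‖ ≤ 1) {p : ℝ × ℝ}
    (hp : (0 ≤ p.1 ∧ p.1 < 1) ∧ 0 ≤ p.2 ∧ p.2 < 1) :
    HasSum (fun n => (taylorCoeff f n * ((p.1 : ℂ) ^ n - (p.2 : ℂ) ^ n)) • T ^ n)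
      (radialDiff f T p) := by
  have h1 := hasSum_radialCalculus hf hT hp.1.1 hp.1.2
  have h2 := hasSum_radialCalculus hf hT hp.2.1 hp.2.2
  have e : (fun n => (taylorCoeff f n * ((p.1 : ℂ) ^ n - (p.2 : ℂ) ^ n)) • T ^ n) =
      fun n => (taylorCoeff f n * (p.1 : ℂ) ^ n) • T ^ n - (taylorCoeff f n * (p.2 : ℂ) ^ n) • T ^ n := by
    funext n
    rw [← sub_smul, mul_sub]
  rw [e]
  exact h1.sub h2

theorem eventually_norm_radialDiff_le (hf : DifferentiableOn ℂ f (ball 0 1))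
    (hf1 : ∀ z ∈ ball (0 : ℂ) 1, ‖f z‖ ≤ 1) (hT : ‖T‖ ≤ 1) :
    ∀ᶠ p in radialPairs, ‖radialDiff f T p‖ ≤ 2 := by
  filter_upwards [eventually_radialPairs] with p hp
  refine (norm_sub_le _ _).trans ?_
  linarith [norm_radialCalculus_le hf hf1 hT hp.1.1 hp.1.2,
    norm_radialCalculus_le hf hf1 hT hp.2.1 hp.2.2]

theorem summable_coeff_sub_sq (hf : DifferentiableOn ℂ f (ball 0 1)) {p : ℝ × ℝ}
    (hp : (0 ≤ p.1 ∧ p.1 < 1) ∧ 0 ≤ p.2 ∧ p.2 < 1) :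
    Summable fun n => ‖taylorCoeff f n * ((p.1 : ℂ) ^ n - (p.2 : ℂ) ^ n)‖ ^ 2 := by
  have h1 := (summable_norm_taylorCoeff hf hp.1.1 hp.1.2).of_norm
  have h2 := (summable_norm_taylorCoeff hf hp.2.1 hp.2.2).of_norm
  have h3 : Summable fun n => ‖taylorCoeff f n * ((p.1 : ℂ) ^ n - (p.2 : ℂ) ^ n)‖ := by
    refine (h1.sub h2).norm.congr fun n => ?_
    rw [mul_sub]
  exact (hasSum_norm_sq_integral h3).summable

/-- After applying the defect operator `D` of `T`, the operators `f(rT)` converge. -/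
theorem tendsto_defect_radialDiff (hf : DifferentiableOn ℂ f (ball 0 1))
    (hf1 : ∀ z ∈ ball (0 : ℂ) 1, ‖f z‖ ≤ 1) (hT : ‖T‖ ≤ 1)
    (hD : adjoint D * D = 1 - adjoint T * T) (x : H) :
    Tendsto (fun p => D (radialDiff f T p x)) radialPairs (𝓝 0) := by
  refine tendsto_of_sq_le (tendsto_tsum_coeff_sub_sq hf hf1) (C := ‖x‖ ^ 2) ?_
  filter_upwards [eventually_radialPairs] with p hp
  have h := hasSum_radialDiff hf hT hp
  rw [← h.tsum_eq]
  exact norm_defect_tsum_smul_pow_sq_le hD h.summable (summable_coeff_sub_sq hf hp) x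

/-- The operators `f(rT)` converge on the range of the adjoint of the defect operator of `T*`. -/
theorem tendsto_radialDiff_adjoint_defect (hf : DifferentiableOn ℂ f (ball 0 1))
    (hf1 : ∀ z ∈ ball (0 : ℂ) 1, ‖f z‖ ≤ 1) (hT : ‖T‖ ≤ 1)
    (hD : adjoint D * D = 1 - T * adjoint T) (x : H) :
    Tendsto (fun p => radialDiff f T p (adjoint D x)) radialPairs (𝓝 0) := by
  refine tendsto_of_sq_le (tendsto_tsum_coeff_sub_sq hf hf1) (C := ‖x‖ ^ 2) ?_
  filter_upwards [eventually_radialPairs] with p hp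
  set S := ∑' n : ℕ, ‖taylorCoeff f n * ((p.1 : ℂ) ^ n - (p.2 : ℂ) ^ n)‖ ^ 2 with hS
  have hS0 : 0 ≤ S := tsum_nonneg fun n => by positivity
  have h := (hasSum_radialDiff hf hT hp).star
  simp only [star_smul, star_pow, star_eq_adjoint] at h
  have hD' : adjoint D * D = 1 - adjoint (adjoint T) * adjoint T := by rwa [adjoint_adjoint]
  have h1 : ‖D * adjoint (radialDiff f T p)‖ ≤ √S := by
    refine opNorm_le_bound _ (Real.sqrt_nonneg _) fun y => ?_
    have h2 := norm_defect_tsum_smul_pow_sq_le hD' h.summable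
      ((summable_coeff_sub_sq hf hp).congr fun n => by rw [norm_star]) y
    rw [h.tsum_eq] at h2
    simp only [norm_star] at h2
    rw [← Real.sqrt_sq (norm_nonneg y), ← Real.sqrt_mul hS0]
    exact Real.le_sqrt_of_sq_le h2
  have h3 : ‖radialDiff f T p * adjoint D‖ ≤ √S := by
    rw [← norm_star, star_mul, star_eq_adjoint, star_eq_adjoint, adjoint_adjoint]
    exact h1
  have h4 := (radialDiff f T p * adjoint D).le_of_opNorm_le h3 x
  calc ‖radialDiff f T p (adjoint D x)‖ ^ 2 ≤ (√S * ‖x‖) ^ 2 := by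
        gcongr
        exact h4
    _ = S * ‖x‖ ^ 2 := by rw [mul_pow, Real.sq_sqrt hS0]

/-- The subspace `K` of the vectors `x` for which `f(rT) x` is Cauchy as `r → 1-` contains the
ranges of `1 - T T*` and of `1 - T* T` and reduces `T`. So `T` is unitary on the complement of `K`,
and this complement vanishes when `T` is completely non-unitary. -/
theorem nullSubspace_radialDiff_eq_top (hf : DifferentiableOn ℂ f (ball 0 1))
    (hf1 : ∀ z ∈ ball (0 : ℂ) 1, ‖f z‖ ≤ 1) (hT : ‖T‖ ≤ 1) (hcnu : IsCNU T) :
    nullSubspace (radialDiff f T) radialPairs = ⊤ := by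
  obtain ⟨D, hD⟩ := exists_defect hT
  obtain ⟨D', hD'⟩ := exists_defect (T := adjoint T) (by rwa [LinearIsometryEquiv.norm_map])
  rw [adjoint_adjoint] at hD'
  set K := nullSubspace (radialDiff f T) radialPairs with hK
  have hclosed : IsClosed (K : Set H) :=
    isClosed_nullSubspace (eventually_norm_radialDiff_le hf hf1 hT)
  have hcomm : ∀ p x, radialDiff f T p (T x) = T (radialDiff f T p x) := fun p x => by
    have h : Commute T (radialDiff f T p) :=
      (commute_radialCalculus (Commute.refl T) f p.1).sub_right
        (commute_radialCalculus (Commute.refl T) f p.2)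
    exact (DFunLike.congr_fun h.eq x).symm
  have hTK : ∀ x ∈ K, T x ∈ K := fun x hx => by
    rw [hK, mem_nullSubspace] at hx ⊢
    simp only [hcomm]
    simpa [Function.comp_def] using (T.continuous.tendsto 0).comp hx
  -- `‖Δ x‖² = ‖Δ T x‖² + ‖D Δ x‖²` for the differences `Δ`
  have hKT : ∀ x, T x ∈ K → x ∈ K := fun x hx => by
    rw [hK, mem_nullSubspace] at hx ⊢
    have h1 := tendsto_defect_radialDiff hf hf1 hT hD x
    refine tendsto_of_sq_le (a := fun p => ‖radialDiff f T p (T x)‖ ^ 2 +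
      ‖D (radialDiff f T p x)‖ ^ 2) (C := 1) ?_ (Eventually.of_forall fun p => ?_)
    · simpa using (hx.norm.pow 2).add (h1.norm.pow 2)
    · rw [norm_defect_sq hD, hcomm]
      linarith
  have h1 : ∀ x, x - T (adjoint T x) ∈ K := fun x => by
    have h := tendsto_radialDiff_adjoint_defect hf hf1 hT hD' (D' x)
    have e : adjoint D' (D' x) = x - T (adjoint T x) := DFunLike.congr_fun hD' x
    rwa [e] at h
  have hTK' : ∀ x ∈ K, adjoint T x ∈ K := fun x hx =>
    hKT _ (by simpa using K.sub_mem hx (h1 x))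
  have h2 : ∀ x, x - adjoint T (T x) ∈ K := fun x =>
    hKT _ (by simpa using h1 (T x))
  have : CompleteSpace K := hclosed.completeSpace_coe
  have hinv : ∀ x ∈ Kᗮ, T x ∈ Kᗮ := fun x hx => by
    rw [Submodule.mem_orthogonal] at hx ⊢
    intro y hy
    rw [← adjoint_inner_left]
    exact hx _ (hTK' y hy)
  have hinv' : ∀ x ∈ Kᗮ, adjoint T x ∈ Kᗮ := fun x hx => by
    rw [Submodule.mem_orthogonal] at hx ⊢
    intro y hy
    rw [adjoint_inner_right]
    exact hx _ (hTK y hy)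
  have hzero : ∀ x, x ∈ K → x ∈ Kᗮ → x = 0 := fun x hx hx' =>
    inner_self_eq_zero.1 ((Submodule.mem_orthogonal K x).1 hx' x hx)
  by_contra hne
  refine hcnu ⟨Kᗮ, ?_, ⟨K.isClosed_orthogonal, hinv, ?_⟩, ⟨hinv, fun x hx => ?_, fun y hy => ?_⟩⟩
  · rwa [Ne, Submodule.orthogonal_eq_bot_iff]
  · rw [Submodule.orthogonal_orthogonal]
    exact hTK
  · have h3 := hzero _ (h2 x) (Kᗮ.sub_mem hx (hinv' _ (hinv _ hx)))
    have h4 : (inner ℂ x x : ℂ) = inner ℂ (T x) (T x) := by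
      rw [← adjoint_inner_right, ← sub_eq_zero.1 h3]
    rw [inner_self_eq_norm_sq_to_K, inner_self_eq_norm_sq_to_K] at h4
    have h5 : ‖x‖ ^ 2 = ‖T x‖ ^ 2 := by exact_mod_cast h4
    exact ((pow_left_inj₀ (norm_nonneg _) (norm_nonneg _) two_ne_zero).1 h5).symm
  · exact ⟨adjoint T y, hinv' _ hy,
      (sub_eq_zero.1 (hzero _ (h1 y) (Kᗮ.sub_mem hy (hinv _ (hinv' _ hy))))).symm⟩

/-- For a completely non-unitary contraction the functional calculus of Sz.-Nagy and Foias exists on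
the unit ball of `H^∞`. -/
theorem exists_isFunctionalCalculus (hf : DifferentiableOn ℂ f (ball 0 1))
    (hf1 : ∀ z ∈ ball (0 : ℂ) 1, ‖f z‖ ≤ 1) (hT : ‖T‖ ≤ 1) (hcnu : IsCNU T) :
    ∃ A : H →L[ℂ] H, ‖A‖ ≤ 1 ∧ ∀ x, Tendsto (fun r => radialCalculus f T r x) (𝓝[<] 1) (𝓝 (A x)) := by
  obtain ⟨A, hA⟩ := exists_clm_tendsto (G := radialCalculus f T) (l := 𝓝[<] (1 : ℝ))
    (nullSubspace_radialDiff_eq_top hf hf1 hT hcnu)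
  refine ⟨A, norm_le_of_tendsto hA zero_le_one ?_, hA⟩
  filter_upwards [Ioo_mem_nhdsLT (show (0 : ℝ) < 1 by norm_num)] with r hr
  exact norm_radialCalculus_le hf hf1 hT hr.1.le hr.2

end Existence

/-! ### The maximal unitary part of a contraction -/

section UnitaryPart

open ContinuousLinearMap

theorem norm_apply_le_of_norm_le_one {H : Type*} [NormedAddCommGroup H] [InnerProductSpace ℂ H]
    {C : H →L[ℂ] H} (hC : ‖C‖ ≤ 1) (x : H) : ‖C x‖ ≤ ‖x‖ := by
  simpa using C.le_of_opNorm_le hC x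

variable {H : Type*} [NormedAddCommGroup H] [InnerProductSpace ℂ H] [CompleteSpace H]

/-- A contraction `C` satisfies `C* C x = x` where it preserves the norm: the equality case of the
Cauchy--Schwarz inequality. -/
theorem adjoint_apply_apply_eq {C : H →L[ℂ] H} (hC : ‖C‖ ≤ 1) {x : H} (h : ‖C x‖ = ‖x‖) :
    adjoint C (C x) = x := by
  have h1 : ‖adjoint C (C x)‖ ≤ ‖x‖ := by
    have := (adjoint C).le_of_opNorm_le (c := 1) (by rwa [LinearIsometryEquiv.norm_map]) (C x)
    rwa [one_mul, h] at this
  have h2 : RCLike.re (inner ℂ (adjoint C (C x)) x) = ‖x‖ ^ 2 := by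
    rw [adjoint_inner_left, inner_self_eq_norm_sq, h]
  have h3 := norm_sub_sq (𝕜 := ℂ) (adjoint C (C x)) x
  rw [h2] at h3
  have h4 : ‖adjoint C (C x) - x‖ ^ 2 ≤ 0 := by
    rw [h3]; nlinarith [norm_nonneg (adjoint C (C x))]
  exact sub_eq_zero.1 (norm_eq_zero.1 (pow_eq_zero_iff two_ne_zero |>.1
    (le_antisymm h4 (by positivity))))

/-- The maximal unitary part of a contraction `C`: the vectors on which all the powers of `C` and of
`C*` are isometric, as expressed by `C*ⁿ Cⁿ x = x = Cⁿ C*ⁿ x`. -/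
def unitaryPart (C : H →L[ℂ] H) : Submodule ℂ H :=
  ⨅ n : ℕ, (adjoint C ^ n * C ^ n - 1).ker ⊓ (C ^ n * adjoint C ^ n - 1).ker

theorem isClosed_unitaryPart (C : H →L[ℂ] H) : IsClosed (unitaryPart C : Set H) := by
  rw [unitaryPart, Submodule.coe_iInf]
  refine isClosed_iInter fun n => ?_
  rw [Submodule.coe_inf]
  exact (isClosed_ker _).inter (isClosed_ker _)

theorem mem_unitaryPart_iff' {C : H →L[ℂ] H} {x : H} : x ∈ unitaryPart C ↔
    ∀ n, (adjoint C ^ n) ((C ^ n) x) = x ∧ (C ^ n) ((adjoint C ^ n) x) = x := by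
  rw [unitaryPart, Submodule.mem_iInf]
  exact forall_congr' fun n => and_congr sub_eq_zero sub_eq_zero

theorem mem_unitaryPart_iff {C : H →L[ℂ] H} (hC : ‖C‖ ≤ 1) {x : H} : x ∈ unitaryPart C ↔
    ∀ n, ‖(C ^ n) x‖ = ‖x‖ ∧ ‖(adjoint C ^ n) x‖ = ‖x‖ := by
  have hC' : ‖adjoint C‖ ≤ 1 := by rwa [LinearIsometryEquiv.norm_map]
  rw [mem_unitaryPart_iff']
  refine forall_congr' fun n => ?_
  have h1 := norm_clm_pow_le_one hC n
  have h2 := norm_clm_pow_le_one hC' n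
  have e : adjoint (C ^ n) = adjoint C ^ n := by
    rw [← star_eq_adjoint, star_pow, star_eq_adjoint]
  have e' : adjoint (adjoint C ^ n) = C ^ n := by rw [← e, adjoint_adjoint]
  refine ⟨fun h => ⟨?_, ?_⟩, fun h => ⟨?_, ?_⟩⟩
  · refine le_antisymm (norm_apply_le_of_norm_le_one h1 x) ?_
    conv_lhs => rw [← h.1]
    exact norm_apply_le_of_norm_le_one h2 _
  · refine le_antisymm (norm_apply_le_of_norm_le_one h2 x) ?_
    conv_lhs => rw [← h.2]
    exact norm_apply_le_of_norm_le_one h1 _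
  · rw [← e]; exact adjoint_apply_apply_eq h1 h.1
  · have := adjoint_apply_apply_eq h2 h.2
    rwa [e'] at this

theorem unitaryPart_adjoint (C : H →L[ℂ] H) : unitaryPart (adjoint C) = unitaryPart C := by
  ext x
  simp only [mem_unitaryPart_iff', adjoint_adjoint, and_comm]

variable {C : H →L[ℂ] H}

theorem norm_apply_of_mem_unitaryPart (hC : ‖C‖ ≤ 1) {x : H} (hx : x ∈ unitaryPart C) :
    ‖C x‖ = ‖x‖ := by
  simpa using ((mem_unitaryPart_iff hC).1 hx 1).1

theorem adjoint_apply_of_mem_unitaryPart {x : H} (hx : x ∈ unitaryPart C) :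
    adjoint C (C x) = x := by
  simpa using (mem_unitaryPart_iff'.1 hx 1).1

theorem apply_adjoint_of_mem_unitaryPart {x : H} (hx : x ∈ unitaryPart C) :
    C (adjoint C x) = x := by
  simpa using (mem_unitaryPart_iff'.1 hx 1).2

theorem adjoint_mem_unitaryPart (hC : ‖C‖ ≤ 1) {x : H} (hx : x ∈ unitaryPart C) :
    adjoint C x ∈ unitaryPart C := by
  have h := (mem_unitaryPart_iff hC).1 hx
  have h1 : ‖adjoint C x‖ = ‖x‖ := by simpa using (h 1).2
  rw [mem_unitaryPart_iff hC]
  intro n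
  constructor
  · rcases n with _ | n
    · simp
    · have e : (C ^ (n + 1)) (adjoint C x) = (C ^ n) (C (adjoint C x)) := by
        rw [pow_succ]; rfl
      rw [e, apply_adjoint_of_mem_unitaryPart hx, (h n).1, h1]
  · have e : (adjoint C ^ n) (adjoint C x) = (adjoint C ^ (n + 1)) x := by rw [pow_succ]; rfl
    rw [e, (h (n + 1)).2, h1]

theorem apply_mem_unitaryPart (hC : ‖C‖ ≤ 1) {x : H} (hx : x ∈ unitaryPart C) :
    C x ∈ unitaryPart C := by
  rw [← unitaryPart_adjoint] at hx ⊢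
  simpa only [adjoint_adjoint] using
    adjoint_mem_unitaryPart (C := adjoint C) (by rwa [LinearIsometryEquiv.norm_map]) hx

theorem adjoint_pow_mem_unitaryPart (hC : ‖C‖ ≤ 1) {x : H} (hx : x ∈ unitaryPart C) (n : ℕ) :
    (adjoint C ^ n) x ∈ unitaryPart C := by
  induction n with
  | zero => simpa using hx
  | succ n ih => rw [pow_succ']; exact adjoint_mem_unitaryPart hC ih

/-- An operator that commutes with `C` and is isometric on the maximal unitary part of `C` leaves
this part invariant. -/
theorem mapsTo_unitaryPart_of_commute (hC : ‖C‖ ≤ 1) {S : H →L[ℂ] H} (hS : Commute S C)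
    (hS1 : ∀ x ∈ unitaryPart C, ‖S x‖ = ‖x‖) {x : H} (hx : x ∈ unitaryPart C) :
    S x ∈ unitaryPart C := by
  have hcomm : ∀ n y, (C ^ n) (S y) = S ((C ^ n) y) := fun n y =>
    (DFunLike.congr_fun (hS.pow_right n).eq y).symm
  have hn : ∀ n, ∀ y ∈ unitaryPart C, (adjoint C ^ n) ((C ^ n) (S y)) = S y := fun n y hy => by
    have e : adjoint (C ^ n) = adjoint C ^ n := by
      rw [← star_eq_adjoint, star_pow, star_eq_adjoint]
    rw [← e]
    refine adjoint_apply_apply_eq (norm_clm_pow_le_one hC n) ?_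
    have hy' : (C ^ n) y ∈ unitaryPart C := by
      clear e
      induction n with
      | zero => simpa using hy
      | succ n ih => rw [pow_succ']; exact apply_mem_unitaryPart hC ih
    rw [hcomm, hS1 _ hy', hS1 _ hy, ((mem_unitaryPart_iff hC).1 hy n).1]
  rw [mem_unitaryPart_iff']
  intro n
  refine ⟨hn n x hx, ?_⟩
  -- write `x = Cⁿ y`
  have hy := adjoint_pow_mem_unitaryPart hC hx n
  have hxy := (mem_unitaryPart_iff'.1 hx n).2
  generalize (adjoint C ^ n) x = y at hy hxy
  rw [← hxy, ← hcomm, hn n y hy]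

/-- Maximality of `unitaryPart`. The subspace `M` is not assumed to reduce `C`, as this is automatic
for a contraction. -/
theorem le_unitaryPart (hC : ‖C‖ ≤ 1) {M : Submodule ℂ H} (hM : IsUnitaryOn C M) :
    M ≤ unitaryPart C := by
  intro x hx
  have h1 : ∀ n, ∀ y ∈ M, (C ^ n) y ∈ M ∧ ‖(C ^ n) y‖ = ‖y‖ ∧ ∃ z ∈ M, (C ^ n) z = y := by
    intro n
    induction n with
    | zero => intro y hy; exact ⟨by simpa using hy, by simp, y, hy, by simp⟩
    | succ n ih =>
      intro y hy
      obtain ⟨a1, a2, z, hz, a3⟩ := ih y hy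
      obtain ⟨w, hw, hwz⟩ := hM.surjOn z hz
      have e : ∀ v, (C ^ (n + 1)) v = C ((C ^ n) v) := fun v => by rw [pow_succ']; rfl
      have e' : ∀ v, (C ^ (n + 1)) v = (C ^ n) (C v) := fun v => by rw [pow_succ]; rfl
      exact ⟨e y ▸ hM.mapsTo _ a1, by rw [e, hM.norm_map _ a1, a2], w, hw, by rw [e', hwz, a3]⟩
  rw [mem_unitaryPart_iff']
  intro n
  have e : adjoint (C ^ n) = adjoint C ^ n := by
    rw [← star_eq_adjoint, star_pow, star_eq_adjoint]
  have h2 : ∀ y ∈ M, (adjoint C ^ n) ((C ^ n) y) = y := fun y hy => by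
    rw [← e]
    exact adjoint_apply_apply_eq (norm_clm_pow_le_one hC n) (h1 n y hy).2.1
  obtain ⟨-, -, z, hz, rfl⟩ := h1 n x hx
  exact ⟨h2 _ hx, by rw [h2 z hz]⟩

end UnitaryPart

/-! ### Complete non-unitarity of the functional calculus -/

section CNU

open Metric ContinuousLinearMap ComplexConjugate

/-- With `y = U x` for an isometry `U`, this says that the Möbius transform
`(U - a) (1 - ā U)⁻¹` is isometric. -/
theorem norm_sub_smul_eq {V : Type*} [NormedAddCommGroup V] [InnerProductSpace ℂ V] {x y : V}
    (h : ‖y‖ = ‖x‖) (a : ℂ) : ‖y - a • x‖ = ‖x - conj a • y‖ := by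
  have h1 : ‖y - a • x‖ ^ 2 = ‖x - conj a • y‖ ^ 2 := by
    rw [norm_sub_sq (𝕜 := ℂ), norm_sub_sq (𝕜 := ℂ), norm_smul, norm_smul, RCLike.norm_conj, h,
      inner_smul_right, inner_smul_right, ← inner_conj_symm x y, ← map_mul, RCLike.conj_re]
  exact (pow_left_inj₀ (norm_nonneg _) (norm_nonneg _) two_ne_zero).1 h1

variable {H : Type*} [NormedAddCommGroup H] [InnerProductSpace ℂ H] [CompleteSpace H]

theorem exists_sub_smul_apply_eq {C : H →L[ℂ] H} (hC : ‖C‖ ≤ 1) {a : ℂ} (ha : ‖a‖ < 1) {y : H}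
    (hy : y ∈ unitaryPart C) : ∃ x ∈ unitaryPart C, x - a • C x = y := by
  have hlt : ‖a • C‖ < 1 := by
    rw [norm_smul]
    exact (mul_le_of_le_one_right (norm_nonneg a) hC).trans_lt ha
  refine ⟨(∑' n : ℕ, (a • C) ^ n) y, ?_, ?_⟩
  · have h := (summable_geometric_of_norm_lt_one hlt).hasSum.mapL (ContinuousLinearMap.apply ℂ H y)
    refine (isClosed_unitaryPart C).mem_of_tendsto h (Eventually.of_forall fun s => ?_)
    refine Submodule.sum_mem _ fun n _ => ?_
    change ((a • C) ^ n) y ∈ unitaryPart C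
    clear * - hy hC
    induction n with
    | zero => simpa using hy
    | succ n ih =>
      rw [pow_succ']
      exact Submodule.smul_mem _ a (apply_mem_unitaryPart hC ih)
  · exact DFunLike.congr_fun (mul_neg_geom_series (a • C) hlt) y

/-- If a Möbius transform of `C` factors as `W T` with contractions `W` and `T`, then `T` is
isometric on the unitary part of `C`, as this Möbius transform is. -/
theorem norm_apply_eq_of_sub_smul_eq {C T W : H →L[ℂ] H} (hC : ‖C‖ ≤ 1) (hT : ‖T‖ ≤ 1)
    (hW : ‖W‖ ≤ 1) {a : ℂ} (ha : ‖a‖ < 1) (h : C - a • 1 = W * (T * (1 - conj a • C))) {y : H}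
    (hy : y ∈ unitaryPart C) : ‖T y‖ = ‖y‖ := by
  refine le_antisymm (norm_apply_le_of_norm_le_one hT y) ?_
  obtain ⟨x, hx, rfl⟩ := exists_sub_smul_apply_eq hC (a := conj a) (by rwa [RCLike.norm_conj]) hy
  have h1 : C x - a • x = W (T (x - conj a • C x)) := DFunLike.congr_fun h x
  rw [← norm_sub_smul_eq (norm_apply_of_mem_unitaryPart hC hx) a, h1]
  exact norm_apply_le_of_norm_le_one hW _

theorem hasUnitaryPart_of_norm_eq {T : H →L[ℂ] H} (hT : ‖T‖ ≤ 1) {N : Submodule ℂ H} (hN : N ≠ ⊥)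
    (hclosed : IsClosed (N : Set H)) (h1 : ∀ x ∈ N, T x ∈ N) (h2 : ∀ x ∈ N, adjoint T x ∈ N)
    (h3 : ∀ x ∈ N, ‖T x‖ = ‖x‖) (h4 : ∀ x ∈ N, ‖adjoint T x‖ = ‖x‖) : HasUnitaryPart T := by
  refine ⟨N, hN, ⟨hclosed, h1, fun x hx => ?_⟩, ⟨h1, h3, fun y hy => ⟨adjoint T y, h2 y hy, ?_⟩⟩⟩
  · rw [Submodule.mem_orthogonal] at hx ⊢
    intro y hy
    rw [← adjoint_inner_left]
    exact hx _ (h2 y hy)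
  · have := adjoint_apply_apply_eq (C := adjoint T) (by rwa [LinearIsometryEquiv.norm_map]) (h4 y hy)
    rwa [adjoint_adjoint] at this

variable {f : ℂ → ℂ}

/-- The Schwarz lemma at the origin for a function `f` on the disc: with `a = f 0`, the Möbius
transform `(f - a) / (1 - ā f)` is `z w(z)` with `|w| ≤ 1`. -/
theorem exists_schwarz_factor (hf : DifferentiableOn ℂ f (ball 0 1))
    (hf1 : ∀ z ∈ ball (0 : ℂ) 1, ‖f z‖ < 1) :
    ∃ w : ℂ → ℂ, DifferentiableOn ℂ w (ball 0 1) ∧ (∀ z ∈ ball (0 : ℂ) 1, ‖w z‖ ≤ 1) ∧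
      ∀ z ∈ ball (0 : ℂ) 1, f z - f 0 = z * w z * (1 - conj (f 0) * f z) := by
  set a := f 0 with ha
  have ha1 : ‖a‖ < 1 := hf1 0 (mem_ball_self one_pos)
  have hne : ∀ z ∈ ball (0 : ℂ) 1, 1 - conj a * f z ≠ 0 := fun z hz h => by
    have h1 : ‖conj a * f z‖ < 1 := by
      rw [norm_mul, RCLike.norm_conj]
      nlinarith [norm_nonneg a, norm_nonneg (f z), hf1 z hz]
    rw [← sub_eq_zero.1 h, norm_one] at h1
    exact lt_irrefl _ h1
  set v : ℂ → ℂ := fun z => (f z - a) / (1 - conj a * f z) with hv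
  have hvd : DifferentiableOn ℂ v (ball 0 1) :=
    (hf.sub_const a).div ((hf.const_mul _).const_sub 1) hne
  have hv0 : v 0 = 0 := by simp [hv, ha]
  have hv1 : Set.MapsTo v (ball 0 1) (closedBall (v 0) 1) := fun z hz => by
    rw [hv0, mem_closedBall_zero_iff, hv, norm_div, div_le_one (norm_pos_iff.2 (hne z hz)),
      ← sq_le_sq₀ (norm_nonneg _) (norm_nonneg _), ← Complex.normSq_eq_norm_sq,
      ← Complex.normSq_eq_norm_sq, Complex.normSq_sub, Complex.normSq_sub]
    have e1 : (f z * conj a).re = (1 * conj (conj a * f z)).re := by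
      simp [mul_comm]
    rw [e1, Complex.normSq_mul, Complex.normSq_conj, Complex.normSq_one, Complex.normSq_eq_norm_sq,
      Complex.normSq_eq_norm_sq]
    have h1 : ‖f z‖ ^ 2 ≤ 1 := pow_le_one₀ (norm_nonneg _) (hf1 z hz).le
    have h2 : ‖a‖ ^ 2 ≤ 1 := pow_le_one₀ (norm_nonneg _) ha1.le
    nlinarith
  refine ⟨dslope v 0, (Complex.differentiableOn_dslope (ball_mem_nhds 0 one_pos)).2 hvd,
    fun z hz => ?_, fun z hz => ?_⟩
  · simpa using Complex.norm_dslope_le_div_of_mapsTo_ball hvd hv1 hz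
  · have h := sub_smul_dslope v 0 z
    rw [sub_zero, smul_eq_mul, hv0, sub_zero] at h
    rw [h, hv, div_mul_cancel₀ _ (hne z hz)]

/-- A function of a completely non-unitary contraction with values in the open disc is completely
non-unitary: by the Schwarz lemma the contraction itself is unitary wherever its function is. -/
theorem isCNU_of_tendsto_radialCalculus (hf : DifferentiableOn ℂ f (ball 0 1))
    (hf1 : ∀ z ∈ ball (0 : ℂ) 1, ‖f z‖ < 1) {T A : H →L[ℂ] H} (hT : ‖T‖ ≤ 1) (hcnu : IsCNU T)
    (hA1 : ‖A‖ ≤ 1)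
    (hA : ∀ x, Tendsto (fun r => radialCalculus f T r x) (𝓝[<] 1) (𝓝 (A x))) : IsCNU A := by
  obtain ⟨w, hw, hw1, hfw⟩ := exists_schwarz_factor hf hf1
  obtain ⟨W, hW1, hW⟩ := exists_isFunctionalCalculus hw hw1 hT hcnu
  set a := f 0 with ha
  have ha1 : ‖a‖ < 1 := hf1 0 (mem_ball_self one_pos)
  have hIoo : ∀ᶠ r : ℝ in 𝓝[<] 1, 0 ≤ r ∧ r < 1 := by
    filter_upwards [Ioo_mem_nhdsLT (show (0 : ℝ) < 1 by norm_num)] with r hr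
    exact ⟨hr.1.le, hr.2⟩
  have hcT : ∀ {S : H →L[ℂ] H}, Commute S T → ∀ {g : ℂ → ℂ} {B : H →L[ℂ] H},
      (∀ x, Tendsto (fun r => radialCalculus g T r x) (𝓝[<] 1) (𝓝 (B x))) → Commute S B := by
    intro S hS g B hB
    refine ContinuousLinearMap.ext fun x => tendsto_nhds_unique
      ((S.continuous.tendsto _).comp (hB x)) ((hB (S x)).congr fun r => ?_)
    exact (DFunLike.congr_fun (commute_radialCalculus hS g r).eq x).symm
  -- the strong limits of the factors of `f(rT) - a`
  have hconst : ∀ c : ℂ, DifferentiableOn ℂ (fun _ => c) (ball (0 : ℂ) 1) := fun c =>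
    differentiableOn_const c
  set g : ℂ → ℂ := (fun _ => (1 : ℂ)) - (fun _ => conj a) * f with hg
  have hgd : DifferentiableOn ℂ g (ball 0 1) := (hconst 1).sub ((hconst _).mul hf)
  have hgr : ∀ r : ℝ, 0 ≤ r ∧ r < 1 → radialCalculus g T r = 1 - conj a • radialCalculus f T r := by
    intro r hr
    rw [hg, radialCalculus_sub (hconst 1) ((hconst _).mul hf) hT hr.1 hr.2,
      radialCalculus_mul (hconst _) hf hT hr.1 hr.2, radialCalculus_const, radialCalculus_const,
      one_smul, smul_mul_assoc, one_mul]
  have hgA : ∀ x, Tendsto (fun r => radialCalculus g T r x) (𝓝[<] 1) (𝓝 ((1 - conj a • A) x)) := by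
    intro x
    have h := ((hA x).const_smul (conj a)).const_sub x
    refine h.congr' ?_
    filter_upwards [hIoo] with r hr
    rw [hgr r hr]
    rfl
  have hidT : ∀ x, Tendsto (fun r => radialCalculus id T r x) (𝓝[<] 1) (𝓝 (T x)) := by
    intro x
    simp only [radialCalculus_id]
    have h : Tendsto (fun r : ℝ => (r : ℂ) • T x) (𝓝[<] 1) (𝓝 (((1 : ℝ) : ℂ) • T x)) := by
      refine Tendsto.mono_left (Continuous.tendsto ?_ 1) nhdsWithin_le_nhds
      fun_prop
    simpa using h
  have hid1 : ∀ᶠ r : ℝ in 𝓝[<] 1, ‖radialCalculus id T r‖ ≤ 1 := by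
    filter_upwards [hIoo] with r hr
    exact norm_radialCalculus_le differentiableOn_id (fun z hz => (mem_ball_zero_iff.1 hz).le) hT
      hr.1 hr.2
  have hw1' : ∀ᶠ r : ℝ in 𝓝[<] 1, ‖radialCalculus w T r‖ ≤ 1 := by
    filter_upwards [hIoo] with r hr
    exact norm_radialCalculus_le hw hw1 hT hr.1 hr.2
  have key : A - a • 1 = W * (T * (1 - conj a • A)) := by
    refine ContinuousLinearMap.ext fun x => tendsto_nhds_unique ((hA x).sub_const (a • x)) ?_
    refine (tendsto_mul_apply hW (tendsto_mul_apply hidT hgA hid1) hw1' x).congr' ?_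
    filter_upwards [hIoo] with r hr
    have e : radialCalculus (f - fun _ => a) T r = radialCalculus (w * (id * g)) T r := by
      refine tsum_congr fun n => ?_
      rw [taylorCoeff_congr (g := w * (id * g)) (fun z hz => ?_) n]
      have := hfw z hz
      simp only [Pi.sub_apply, Pi.mul_apply, hg, id_eq]
      rw [this]
      ring
    rw [← radialCalculus_mul differentiableOn_id hgd hT hr.1 hr.2,
      ← radialCalculus_mul hw (differentiableOn_id.mul hgd) hT hr.1 hr.2, ← e,
      radialCalculus_sub hf (hconst a) hT hr.1 hr.2, radialCalculus_const]
    rfl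
  have hTA : Commute T A := hcT (Commute.refl T) hA
  have hTW : Commute T W := hcT (Commute.refl T) hW
  have hAW : Commute A W := hcT hTA.symm hW
  -- the factors of `key` commute, so the adjoint has the same form
  have key' : adjoint A - conj a • 1 = adjoint W * (adjoint T * (1 - conj (conj a) • adjoint A)) := by
    have hGT : Commute T (1 - conj a • A) := (Commute.one_right T).sub_right (hTA.smul_right _)
    have hGW : Commute W (1 - conj a • A) :=
      (Commute.one_right W).sub_right (hAW.symm.smul_right _)
    have h : A - a • 1 = (1 - conj a • A) * T * W := by
      rw [key, hGT.eq, ← mul_assoc, hGW.eq, mul_assoc, mul_assoc, hTW.eq]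
    have h' := congrArg star h
    simpa only [star_sub, star_mul, star_smul, star_one, star_eq_adjoint, RCLike.star_def] using h'
  have hadj : ∀ {B : H →L[ℂ] H}, ‖B‖ ≤ 1 → ‖adjoint B‖ ≤ 1 := fun hB => by
    rwa [LinearIsometryEquiv.norm_map]
  rintro ⟨M, hM0, -, hM⟩
  have hN0 : unitaryPart A ≠ ⊥ := fun h => hM0 (le_bot_iff.1 (h ▸ le_unitaryPart hA1 hM))
  have h3 : ∀ x ∈ unitaryPart A, ‖T x‖ = ‖x‖ := fun x hx =>
    norm_apply_eq_of_sub_smul_eq hA1 hT hW1 ha1 key hx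
  have h4 : ∀ x ∈ unitaryPart A, ‖adjoint T x‖ = ‖x‖ := fun x hx =>
    norm_apply_eq_of_sub_smul_eq (hadj hA1) (hadj hT) (hadj hW1) (by rwa [RCLike.norm_conj]) key'
      (by rwa [unitaryPart_adjoint])
  refine hcnu (hasUnitaryPart_of_norm_eq hT hN0 (isClosed_unitaryPart A)
    (fun x hx => mapsTo_unitaryPart_of_commute hA1 hTA h3 hx) (fun x hx => ?_) h3 h4)
  have hTA' : Commute (adjoint T) (adjoint A) := hTA.star_star
  rw [← unitaryPart_adjoint] at hx ⊢
  refine mapsTo_unitaryPart_of_commute (hadj hA1) hTA' (fun y hy => ?_) hx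
  rw [unitaryPart_adjoint] at hy
  exact h4 y hy

end CNU

/-! ### Laurent operators, the bilateral shift, and Toeplitz operators -/

section Laurent

open ContinuousLinearMap

theorem integrable_LTwo {V : Type*} [NormedAddCommGroup V] (f : Lp V 2 leb) :
    Integrable (f : Torus → V) leb :=
  (Lp.memLp f).integrable (by norm_num)

variable {E : Type u} [NormedAddCommGroup E] [InnerProductSpace ℂ E]

theorem inner_LTwo (f g : LTwo E) :
    inner ℂ f g = ∫ t, inner ℂ ((f : Torus → E) t) ((g : Torus → E) t) ∂leb := L2.inner_def f g

variable [CompleteSpace E]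

theorem LTwo_eq_zero {f : LTwo E} (h : ∀ n : ℤ, fourierCoeff (f : Torus → E) n = 0) : f = 0 := by
  have h1 := ae_eq_of_fourierCoeff_eq (integrable_LTwo f) (g := fun _ => (0 : E))
    (integrable_const _) fun n => by rw [h]; simp [fourierCoeff]
  exact (Lp.eq_zero_iff_ae_eq_zero).2 h1

theorem IsLInfty.adjoint {Φ : Torus → E →L[ℂ] E} (hΦ : IsLInfty Φ) :
    IsLInfty fun t => ContinuousLinearMap.adjoint (Φ t) where
  measurable := hΦ.measurable_adjoint
  measurable_adjoint x := by simpa only [adjoint_adjoint] using hΦ.measurable x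
  bounded := by
    obtain ⟨C, hC⟩ := hΦ.bounded
    refine ⟨C, hC.mono fun t ht => ?_⟩
    rwa [LinearIsometryEquiv.norm_map]

theorem laurent_adjoint {Φ : Torus → E →L[ℂ] E} (hΦ : IsLInfty Φ) :
    laurent hΦ.adjoint = adjoint (laurent hΦ) := by
  rw [eq_adjoint_iff]
  intro f g
  rw [inner_LTwo, inner_LTwo]
  refine integral_congr_ae ?_
  filter_upwards [coeFn_laurent hΦ.adjoint f, coeFn_laurent hΦ g] with t h1 h2
  rw [h1, h2, adjoint_inner_left]

theorem isLInfty_fourier (n : ℤ) :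
    IsLInfty fun t : Torus => (fourier n t : ℂ) • (1 : E →L[ℂ] E) where
  measurable x := ((map_continuous (fourier n)).smul continuous_const).aestronglyMeasurable
  measurable_adjoint x := by
    have h : ∀ t : Torus, ContinuousLinearMap.adjoint ((fourier n t : ℂ) • (1 : E →L[ℂ] E)) x =
        (starRingEnd ℂ) (fourier n t : ℂ) • x := fun t => by
      rw [map_smulₛₗ, ← star_eq_adjoint, star_one]; rfl
    simp only [h]
    exact ((Complex.continuous_conj.comp (map_continuous (fourier n))).smul
      continuous_const).aestronglyMeasurable
  bounded := ⟨1, Eventually.of_forall fun t => by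
    rw [norm_smul, norm_fourier_apply, one_mul]; exact norm_id_le⟩

/-- The `n`-th power of the bilateral shift: multiplication by `e^{2πint}` on `L²`. -/
def mulFourier (n : ℤ) : LTwo E →L[ℂ] LTwo E := laurent (isLInfty_fourier n)

theorem coeFn_mulFourier (n : ℤ) (f : LTwo E) :
    (mulFourier n f : Torus → E) =ᵐ[leb] fun t => (fourier n t : ℂ) • (f : Torus → E) t :=
  coeFn_laurent (isLInfty_fourier n) f

theorem mulFourier_mulFourier (m n : ℤ) (f : LTwo E) :
    mulFourier m (mulFourier n f) = mulFourier (m + n) f := by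
  refine Lp.ext ?_
  filter_upwards [coeFn_mulFourier m (mulFourier n f), coeFn_mulFourier n f,
    coeFn_mulFourier (m + n) f] with t h1 h2 h3
  rw [h1, h2, h3, smul_smul, ← fourier_add]

theorem mulFourier_zero (f : LTwo E) : mulFourier 0 f = f := by
  refine Lp.ext ?_
  filter_upwards [coeFn_mulFourier 0 f] with t h1
  rw [h1, fourier_zero, one_smul]

theorem inner_mulFourier_left (n : ℤ) (f g : LTwo E) :
    inner ℂ (mulFourier n f) g = inner ℂ f (mulFourier (-n) g) := by
  rw [inner_LTwo, inner_LTwo]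
  refine integral_congr_ae ?_
  filter_upwards [coeFn_mulFourier n f, coeFn_mulFourier (-n) g] with t h1 h2
  rw [h1, h2, inner_smul_left, inner_smul_right, fourier_neg]

theorem norm_mulFourier (n : ℤ) (f : LTwo E) : ‖mulFourier n f‖ = ‖f‖ := by
  have h : (inner ℂ (mulFourier n f) (mulFourier n f) : ℂ) = inner ℂ f f := by
    rw [inner_mulFourier_left, mulFourier_mulFourier, neg_add_cancel, mulFourier_zero]
  rw [inner_self_eq_norm_sq_to_K, inner_self_eq_norm_sq_to_K] at h
  have h5 : ‖mulFourier n f‖ ^ 2 = ‖f‖ ^ 2 := by exact_mod_cast h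
  exact (pow_left_inj₀ (norm_nonneg _) (norm_nonneg _) two_ne_zero).1 h5

theorem fourierCoeff_mulFourier (n k : ℤ) (f : LTwo E) :
    fourierCoeff (mulFourier n f : Torus → E) k = fourierCoeff (f : Torus → E) (k - n) := by
  rw [fourierCoeff_congr_ae (coeFn_mulFourier n f)]
  refine integral_congr_ae (Eventually.of_forall fun t => ?_)
  simp only [smul_smul, ← fourier_add]
  congr 3
  ring

theorem laurent_mulFourier {Φ : Torus → E →L[ℂ] E} (hΦ : IsLInfty Φ) (n : ℤ) (f : LTwo E) :
    laurent hΦ (mulFourier n f) = mulFourier n (laurent hΦ f) := by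
  refine Lp.ext ?_
  filter_upwards [coeFn_mulFourier n f, coeFn_mulFourier n (laurent hΦ f),
    coeFn_laurent hΦ f, coeFn_laurent hΦ (mulFourier n f)] with t h1 h2 h3 h4
  rw [h4, h1, h2, h3, map_smul]

theorem mulFourier_mem_HTwo {n : ℤ} (hn : 0 ≤ n) {f : LTwo E} (hf : f ∈ HTwo E) :
    mulFourier n f ∈ HTwo E := fun k hk => by
  rw [fourierCoeff_mulFourier]
  exact hf _ (by omega)

/-- Translates `zⁿ f` of a function in `L²` are asymptotically in `H²`. -/
theorem tendsto_mulFourier_sub_starProjection (f : LTwo E) :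
    Tendsto (fun n : ℕ => mulFourier (n : ℤ) f - (HTwo E).starProjection (mulFourier (n : ℤ) f))
      atTop (𝓝 0) := by
  set G : ℕ → LTwo E →L[ℂ] LTwo E :=
    fun n => (1 - (HTwo E).starProjection) * mulFourier (n : ℤ) with hG
  suffices h : nullSubspace G atTop = ⊤ by
    have hf : f ∈ nullSubspace G atTop := h ▸ Submodule.mem_top
    exact mem_nullSubspace.1 hf
  have hclosed : IsClosed (nullSubspace G atTop : Set (LTwo E)) := by
    refine isClosed_nullSubspace (C := 2) (Eventually.of_forall fun n => ?_)
    refine opNorm_le_bound _ two_pos.le fun g => ?_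
    change ‖mulFourier (n : ℤ) g - (HTwo E).starProjection (mulFourier (n : ℤ) g)‖ ≤ _
    have h1 := (HTwo E).norm_starProjection_apply_le (mulFourier (n : ℤ) g)
    have h2 := norm_sub_le (mulFourier (n : ℤ) g) ((HTwo E).starProjection (mulFourier (n : ℤ) g))
    rw [norm_mulFourier] at h1 h2
    linarith
  have : CompleteSpace (nullSubspace G atTop) := hclosed.completeSpace_coe
  rw [← Submodule.orthogonal_eq_bot_iff, Submodule.eq_bot_iff]
  intro g hg
  -- `g` is orthogonal to the constant functions and their translates
  refine LTwo_eq_zero fun m => ?_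
  refine ext_inner_left ℂ fun x => ?_
  set c : LTwo E := (memLp_const x).toLp (fun _ : Torus => x) with hc
  have hcoe : (c : Torus → E) =ᵐ[leb] fun _ => x := MemLp.coeFn_toLp _
  have hcH : c ∈ HTwo E := fun k hk => by
    rw [fourierCoeff_congr_ae hcoe, fourierCoeff, integral_smul_const, integral_fourier,
      if_neg (by omega), zero_smul]
  have hmem : mulFourier m c ∈ nullSubspace G atTop := by
    rw [mem_nullSubspace]
    refine tendsto_const_nhds.congr' ?_
    filter_upwards [eventually_ge_atTop m.natAbs] with n hn
    change 0 = mulFourier (n : ℤ) (mulFourier m c) -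
      (HTwo E).starProjection (mulFourier (n : ℤ) (mulFourier m c))
    rw [mulFourier_mulFourier, Submodule.starProjection_eq_self_iff.2
      (mulFourier_mem_HTwo (by omega) hcH), sub_self]
  have h0 := (Submodule.mem_orthogonal _ _).1 hg _ hmem
  rw [inner_LTwo] at h0
  rw [inner_zero_right, ← h0, fourierCoeff, ← integral_inner ((integrable_LTwo g).fourier_smul (-m)) x]
  refine integral_congr_ae ?_
  filter_upwards [coeFn_mulFourier m c, hcoe] with t h1 h2
  rw [h1, h2, inner_smul_left, inner_smul_right, fourier_neg]

variable {Φ : Torus → E →L[ℂ] E}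

theorem coe_toeplitz (hΦ : IsLInfty Φ) (f : HTwo E) :
    (toeplitz hΦ f : LTwo E) = (HTwo E).starProjection (laurent hΦ f) := rfl

/-- A Laurent operator is bounded by the norm of the Toeplitz operator with the same symbol: it
commutes with the bilateral shift, which moves every function asymptotically into `H²`. -/
theorem norm_laurent_apply_le (hΦ : IsLInfty Φ) (f : LTwo E) :
    ‖laurent hΦ f‖ ≤ ‖toeplitz hΦ‖ * ‖f‖ := by
  set P := (HTwo E).starProjection with hP
  have h1 : Tendsto (fun n : ℕ => ‖P (mulFourier (n : ℤ) (laurent hΦ f))‖) atTop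
      (𝓝 ‖laurent hΦ f‖) := by
    have h := (tendsto_mulFourier_sub_starProjection (laurent hΦ f)).norm
    rw [norm_zero] at h
    rw [tendsto_iff_norm_sub_tendsto_zero]
    refine squeeze_zero (fun n => norm_nonneg _) (fun n => ?_) h
    rw [← norm_mulFourier (n : ℤ) (laurent hΦ f), Real.norm_eq_abs, abs_sub_comm]
    exact abs_norm_sub_norm_le _ _
  have h2 : Tendsto (fun n : ℕ => ‖toeplitz hΦ‖ * ‖f‖ +
      ‖laurent hΦ‖ * ‖mulFourier (n : ℤ) f - P (mulFourier (n : ℤ) f)‖) atTop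
      (𝓝 (‖toeplitz hΦ‖ * ‖f‖)) := by
    have h := (tendsto_mulFourier_sub_starProjection f).norm
    rw [norm_zero] at h
    simpa using (h.const_mul ‖laurent hΦ‖).const_add (‖toeplitz hΦ‖ * ‖f‖)
  refine le_of_tendsto_of_tendsto' h1 h2 fun n => ?_
  set g := mulFourier (n : ℤ) f with hg
  have hPg : P g ∈ HTwo E := Submodule.starProjection_apply_mem _ _
  have h3 : P (laurent hΦ g) = P (laurent hΦ (P g)) + P (laurent hΦ (g - P g)) := by
    rw [← map_add, ← map_add, add_sub_cancel]
  have h4 : ‖P (laurent hΦ (P g))‖ ≤ ‖toeplitz hΦ‖ * ‖f‖ := by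
    have h5 : ‖toeplitz hΦ ⟨P g, hPg⟩‖ ≤ ‖toeplitz hΦ‖ * ‖P g‖ := (toeplitz hΦ).le_opNorm _
    refine h5.trans ?_
    gcongr
    rw [← norm_mulFourier (n : ℤ) f]
    exact (HTwo E).norm_starProjection_apply_le g
  rw [← laurent_mulFourier, h3]
  refine (norm_add_le _ _).trans (add_le_add h4 ?_)
  exact ((HTwo E).norm_starProjection_apply_le _).trans ((laurent hΦ).le_opNorm _)

theorem toeplitz_adjoint (hΦ : IsLInfty Φ) : toeplitz hΦ.adjoint = adjoint (toeplitz hΦ) := by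
  rw [eq_adjoint_iff]
  intro f g
  rw [Submodule.coe_inner, Submodule.coe_inner, coe_toeplitz, coe_toeplitz,
    Submodule.inner_starProjection_left_eq_right, Submodule.starProjection_eq_self_iff.2 g.2,
    ← Submodule.inner_starProjection_left_eq_right, Submodule.starProjection_eq_self_iff.2 f.2,
    laurent_adjoint, adjoint_inner_left]

/-- A contractive Toeplitz operator agrees with the Laurent operator at any vector whose norm it
preserves, since then the projection onto `H²` loses no norm. -/
theorem laurent_eq_toeplitz (hΦ : IsLInfty Φ) (hT : ‖toeplitz hΦ‖ ≤ 1) {f : HTwo E}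
    (hf : ‖toeplitz hΦ f‖ = ‖f‖) : laurent hΦ (f : LTwo E) = toeplitz hΦ f := by
  rw [coe_toeplitz]
  symm
  rw [Submodule.starProjection_eq_self_iff, Submodule.mem_iff_norm_starProjection]
  refine le_antisymm ((HTwo E).norm_starProjection_apply_le _) ?_
  rw [← coe_toeplitz, Submodule.norm_coe, hf]
  refine (norm_laurent_apply_le hΦ _).trans ?_
  exact mul_le_of_le_one_left (norm_nonneg _) hT

end Laurent

/-! ### Wandering vectors in the unitary part -/

section Wandering

open ContinuousLinearMap

variable {E : Type u} [NormedAddCommGroup E] [InnerProductSpace ℂ E] [CompleteSpace E]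
  {Φ : Torus → E →L[ℂ] E}

theorem isUnitaryOn_adjoint {H : Type*} [NormedAddCommGroup H] [InnerProductSpace ℂ H]
    [CompleteSpace H] {T : H →L[ℂ] H} (hT : ‖T‖ ≤ 1) {M : Submodule ℂ H} (hM : IsUnitaryOn T M) :
    IsUnitaryOn (adjoint T) M := by
  have h : ∀ x ∈ M, adjoint T (T x) = x := fun x hx => adjoint_apply_apply_eq hT (hM.norm_map x hx)
  refine ⟨fun x hx => ?_, fun x hx => ?_, fun y hy => ⟨T y, hM.mapsTo y hy, h y hy⟩⟩
  · obtain ⟨z, hz, rfl⟩ := hM.surjOn x hx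
    rwa [h z hz]
  · obtain ⟨z, hz, rfl⟩ := hM.surjOn x hx
    rw [h z hz, hM.norm_map z hz]

/-- The vectors in the unitary part of `L` whose full orbit under `L` and `L*` stays in the subspace
`K`. -/
def unitaryPartIn {H : Type*} [NormedAddCommGroup H] [InnerProductSpace ℂ H] [CompleteSpace H]
    (L : H →L[ℂ] H) (K : Submodule ℂ H) : Submodule ℂ H :=
  unitaryPart L ⊓ ⨅ n : ℕ, K.comap (L ^ n : H →L[ℂ] H).toLinearMap ⊓
    K.comap (adjoint L ^ n : H →L[ℂ] H).toLinearMap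

section

variable {H : Type*} [NormedAddCommGroup H] [InnerProductSpace ℂ H] [CompleteSpace H]
  {L : H →L[ℂ] H} {K : Submodule ℂ H}

theorem mem_unitaryPartIn {x : H} : x ∈ unitaryPartIn L K ↔
    x ∈ unitaryPart L ∧ ∀ n, (L ^ n) x ∈ K ∧ (adjoint L ^ n) x ∈ K := by
  rw [unitaryPartIn, Submodule.mem_inf, Submodule.mem_iInf]
  rfl

theorem unitaryPartIn_le : unitaryPartIn L K ≤ K := fun x hx => by
  simpa using ((mem_unitaryPartIn.1 hx).2 0).1

theorem isClosed_unitaryPartIn (hK : IsClosed (K : Set H)) :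
    IsClosed (unitaryPartIn L K : Set H) := by
  have h : (unitaryPartIn L K : Set H) = (unitaryPart L : Set H) ∩
      ⋂ n : ℕ, (⇑(L ^ n) ⁻¹' K) ∩ (⇑(adjoint L ^ n) ⁻¹' K) := by
    ext x
    rw [SetLike.mem_coe, mem_unitaryPartIn, Set.mem_inter_iff, Set.mem_iInter]
    rfl
  rw [h]
  exact (isClosed_unitaryPart L).inter (isClosed_iInter fun n =>
    (hK.preimage (L ^ n).continuous).inter (hK.preimage (adjoint L ^ n).continuous))

theorem unitaryPartIn_adjoint : unitaryPartIn (adjoint L) K = unitaryPartIn L K := by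
  ext x
  simp only [mem_unitaryPartIn, unitaryPart_adjoint, adjoint_adjoint, and_comm]

theorem apply_mem_unitaryPartIn (hL : ‖L‖ ≤ 1) {x : H} (hx : x ∈ unitaryPartIn L K) :
    L x ∈ unitaryPartIn L K := by
  have h := mem_unitaryPartIn.1 hx
  refine mem_unitaryPartIn.2 ⟨apply_mem_unitaryPart hL h.1, fun n => ⟨?_, ?_⟩⟩
  · have e : (L ^ n) (L x) = (L ^ (n + 1)) x := by rw [pow_succ]; rfl
    rw [e]; exact (h.2 (n + 1)).1
  · rcases n with _ | n
    · simpa using (h.2 1).1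
    · have e : (adjoint L ^ (n + 1)) (L x) = (adjoint L ^ n) (adjoint L (L x)) := by
        rw [pow_succ]; rfl
      rw [e, adjoint_apply_of_mem_unitaryPart h.1]
      exact (h.2 n).2

theorem adjoint_apply_mem_unitaryPartIn (hL : ‖L‖ ≤ 1) {x : H} (hx : x ∈ unitaryPartIn L K) :
    adjoint L x ∈ unitaryPartIn L K := by
  rw [← unitaryPartIn_adjoint] at hx ⊢
  exact apply_mem_unitaryPartIn (by rwa [LinearIsometryEquiv.norm_map]) hx

end

theorem norm_laurent_le (hΦ : IsLInfty Φ) (hT : ‖toeplitz hΦ‖ ≤ 1) : ‖laurent hΦ‖ ≤ 1 :=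
  opNorm_le_bound _ zero_le_one fun f => (norm_laurent_apply_le hΦ f).trans (by gcongr)

theorem norm_toeplitz_adjoint_le (hΦ : IsLInfty Φ) (hT : ‖toeplitz hΦ‖ ≤ 1) :
    ‖toeplitz hΦ.adjoint‖ ≤ 1 := by
  rwa [toeplitz_adjoint, LinearIsometryEquiv.norm_map]

theorem laurent_pow_eq_toeplitz_pow (hΦ : IsLInfty Φ) (hT : ‖toeplitz hΦ‖ ≤ 1)
    {M : Submodule ℂ (HTwo E)} (hM : IsUnitaryOn (toeplitz hΦ) M) {f : HTwo E} (hf : f ∈ M) (n : ℕ) :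
    (laurent hΦ ^ n) (f : LTwo E) = ((toeplitz hΦ ^ n) f : HTwo E) ∧ (toeplitz hΦ ^ n) f ∈ M := by
  induction n with
  | zero => exact ⟨rfl, hf⟩
  | succ n ih =>
    have e1 : (laurent hΦ ^ (n + 1)) (f : LTwo E) = laurent hΦ ((laurent hΦ ^ n) f) := by
      rw [pow_succ']; rfl
    have e2 : (toeplitz hΦ ^ (n + 1)) f = toeplitz hΦ ((toeplitz hΦ ^ n) f) := by
      rw [pow_succ']; rfl
    rw [e1, e2, ih.1]
    exact ⟨laurent_eq_toeplitz hΦ hT (hM.norm_map _ ih.2), hM.mapsTo _ ih.2⟩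

/-- The Laurent operator is unitary on the unitary part of a contractive Toeplitz operator. -/
theorem coe_mem_unitaryPartIn (hΦ : IsLInfty Φ) (hT : ‖toeplitz hΦ‖ ≤ 1)
    {M : Submodule ℂ (HTwo E)} (hM : IsUnitaryOn (toeplitz hΦ) M) {f : HTwo E} (hf : f ∈ M) :
    (f : LTwo E) ∈ unitaryPartIn (laurent hΦ) (HTwo E) := by
  have hM' : IsUnitaryOn (toeplitz hΦ.adjoint) M := by
    rw [toeplitz_adjoint]; exact isUnitaryOn_adjoint hT hM
  have h2 := laurent_pow_eq_toeplitz_pow hΦ hT hM hf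
  have h3 := laurent_pow_eq_toeplitz_pow hΦ.adjoint (norm_toeplitz_adjoint_le hΦ hT) hM' hf
  rw [laurent_adjoint hΦ] at h3
  refine mem_unitaryPartIn.2 ⟨?_, fun n => ⟨?_, ?_⟩⟩
  · have hU : IsUnitaryOn (laurent hΦ) (M.map (HTwo E).subtype) := by
      have e : ∀ g ∈ M, laurent hΦ (g : LTwo E) = toeplitz hΦ g := fun g hg =>
        laurent_eq_toeplitz hΦ hT (hM.norm_map _ hg)
      refine ⟨?_, ?_, ?_⟩
      · rintro _ ⟨g, hg, rfl⟩
        exact ⟨toeplitz hΦ g, hM.mapsTo g hg, (e g hg).symm⟩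
      · rintro _ ⟨g, hg, rfl⟩
        rw [Submodule.subtype_apply, e g hg, Submodule.norm_coe, Submodule.norm_coe,
          hM.norm_map g hg]
      · rintro _ ⟨g, hg, rfl⟩
        obtain ⟨k, hk, rfl⟩ := hM.surjOn g hg
        exact ⟨k, ⟨k, hk, rfl⟩, e k hk⟩
    exact le_unitaryPart (norm_laurent_le hΦ hT) hU ⟨f, hf, rfl⟩
  · rw [(h2 n).1]; exact Subtype.coe_prop _
  · rw [(h3 n).1]; exact Subtype.coe_prop _

theorem mulFourier_mem_unitaryPartIn (hΦ : IsLInfty Φ) (hT : ‖toeplitz hΦ‖ ≤ 1) {f : LTwo E}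
    (hf : f ∈ unitaryPartIn (laurent hΦ) (HTwo E)) {m : ℤ} (hm : 0 ≤ m) :
    mulFourier m f ∈ unitaryPartIn (laurent hΦ) (HTwo E) := by
  have h := mem_unitaryPartIn.1 hf
  have c1 : Commute (mulFourier m) (laurent hΦ) :=
    ContinuousLinearMap.ext fun g => (laurent_mulFourier hΦ m g).symm
  have c2 : Commute (mulFourier m) (adjoint (laurent hΦ)) := by
    rw [← laurent_adjoint]
    exact ContinuousLinearMap.ext fun g => (laurent_mulFourier hΦ.adjoint m g).symm
  refine mem_unitaryPartIn.2 ⟨mapsTo_unitaryPart_of_commute (norm_laurent_le hΦ hT) c1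
    (fun x _ => norm_mulFourier m x) h.1, fun n => ⟨?_, ?_⟩⟩
  · have e : (laurent hΦ ^ n) (mulFourier m f) = mulFourier m ((laurent hΦ ^ n) f) :=
      (DFunLike.congr_fun (c1.pow_right n).eq f).symm
    rw [e]; exact mulFourier_mem_HTwo hm (h.2 n).1
  · have e : (adjoint (laurent hΦ) ^ n) (mulFourier m f) =
        mulFourier m ((adjoint (laurent hΦ) ^ n) f) :=
      (DFunLike.congr_fun (c2.pow_right n).eq f).symm
    rw [e]; exact mulFourier_mem_HTwo hm (h.2 n).2

/-- A non-zero closed shift-invariant subspace of `H²` is not its own image under the shift, as all its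
elements would vanish to infinite order at the origin; so it contains a wandering vector. -/
theorem exists_wandering {N : Submodule ℂ (LTwo E)} (hN : IsClosed (N : Set (LTwo E)))
    (hNH : N ≤ HTwo E) (hS : ∀ f ∈ N, mulFourier 1 f ∈ N) (h0 : N ≠ ⊥) :
    ∃ f ∈ N, f ≠ 0 ∧ ∀ g ∈ N, inner ℂ (mulFourier 1 g) f = 0 := by
  by_contra! hcon
  have hiso : Isometry (mulFourier (E := E) 1) :=
    AddMonoidHomClass.isometry_of_norm _ (norm_mulFourier 1)
  set R := N.map (mulFourier (E := E) 1).toLinearMap with hR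
  have hRc : IsClosed (R : Set (LTwo E)) := hiso.isClosedEmbedding.isClosedMap _ hN
  have : CompleteSpace R := hRc.completeSpace_coe
  have hRN : R ≤ N := by
    rintro _ ⟨g, hg, rfl⟩
    exact hS g hg
  have hsurj : ∀ f ∈ N, ∃ g ∈ N, mulFourier 1 g = f := fun f hf => by
    have h1 : R.starProjection f ∈ R := Submodule.starProjection_apply_mem _ _
    have h2 : f - R.starProjection f = 0 := by
      by_contra hne
      obtain ⟨g, hg, hgf⟩ := hcon _ (N.sub_mem hf (hRN h1)) hne
      exact hgf ((Submodule.mem_orthogonal _ _).1 (R.sub_starProjection_mem_orthogonal f) _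
        ⟨g, hg, rfl⟩)
    rw [← sub_eq_zero.1 h2] at h1
    exact h1
  have hpow : ∀ k : ℕ, ∀ f ∈ N, ∃ g ∈ N, mulFourier (k : ℤ) g = f := fun k => by
    induction k with
    | zero => exact fun f hf => ⟨f, hf, mulFourier_zero f⟩
    | succ k ih =>
      intro f hf
      obtain ⟨g, hg, rfl⟩ := ih f hf
      obtain ⟨h, hh, rfl⟩ := hsurj g hg
      exact ⟨h, hh, by rw [mulFourier_mulFourier]; push_cast; rfl⟩
  refine h0 ((Submodule.eq_bot_iff _).2 fun f hf => LTwo_eq_zero fun m => ?_)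
  obtain ⟨g, hg, rfl⟩ := hpow (m.toNat + 1) f hf
  rw [fourierCoeff_mulFourier]
  exact hNH hg _ (by omega)

/-- If `f` is orthogonal to its translates `zⁿ f`, `n ≥ 1`, then `f` has constant norm on the circle,
as all the Fourier coefficients of `‖f‖²` of non-zero index vanish. -/
theorem ae_norm_eq_of_wandering {f : LTwo E}
    (hf : ∀ n : ℕ, 0 < n → inner ℂ (mulFourier (n : ℤ) f) f = 0) :
    ∀ᵐ t ∂leb, ‖(f : Torus → E) t‖ = ‖f‖ := by
  have hi : Integrable (fun t => inner ℂ ((f : Torus → E) t) ((f : Torus → E) t)) leb :=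
    L2.integrable_inner (𝕜 := ℂ) f f
  have hcoeff : ∀ n : ℤ, fourierCoeff (fun t => inner ℂ ((f : Torus → E) t) ((f : Torus → E) t)) n =
      inner ℂ (mulFourier n f) f := fun n => by
    rw [inner_LTwo, fourierCoeff]
    refine integral_congr_ae ?_
    filter_upwards [coeFn_mulFourier n f] with t h1
    rw [h1, inner_smul_left, fourier_neg, smul_eq_mul]
  have hzero : ∀ n : ℤ, n ≠ 0 → inner ℂ (mulFourier n f) f = 0 := fun n hn => by
    rcases lt_or_gt_of_ne hn with h | h
    · rw [inner_mulFourier_left, ← inner_conj_symm]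
      have := hf (-n).toNat (by omega)
      rw [Int.toNat_of_nonneg (by omega)] at this
      rw [this, map_zero]
    · have := hf n.toNat (by omega)
      rwa [Int.toNat_of_nonneg (by omega)] at this
  have h := ae_eq_of_fourierCoeff_eq hi (g := fun _ => (inner ℂ f f : ℂ)) (integrable_const _)
    fun n => by
      rw [hcoeff, fourierCoeff, integral_smul_const, integral_fourier]
      by_cases hn : n = 0
      · subst hn
        rw [mulFourier_zero, if_pos (by simp), one_smul]
      · rw [hzero n hn, if_neg (by simpa using hn), zero_smul]
  filter_upwards [h] with t ht
  rw [inner_self_eq_norm_sq_to_K, inner_self_eq_norm_sq_to_K] at ht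
  have h5 : ‖(f : Torus → E) t‖ ^ 2 = ‖f‖ ^ 2 := by exact_mod_cast ht
  exact (pow_left_inj₀ (norm_nonneg _) (norm_nonneg _) two_ne_zero).1 h5

/-- The closed span of the orbit of `x` under `L` and `L*`. It is separable, also when the ambient space
is not. -/
def orbitSpan {H : Type*} [NormedAddCommGroup H] [InnerProductSpace ℂ H] [CompleteSpace H]
    (L : H →L[ℂ] H) (x : H) : Submodule ℂ H :=
  (Submodule.span ℂ ((Set.range fun n : ℕ => (L ^ n) x) ∪
    Set.range fun n : ℕ => (adjoint L ^ n) x)).topologicalClosure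

section

variable {H : Type*} [NormedAddCommGroup H] [InnerProductSpace ℂ H] [CompleteSpace H]
  {L : H →L[ℂ] H} {x : H}

theorem self_mem_orbitSpan : x ∈ orbitSpan L x :=
  Submodule.le_topologicalClosure _ (Submodule.subset_span (Or.inl ⟨0, rfl⟩))

theorem isClosed_orbitSpan : IsClosed (orbitSpan L x : Set H) :=
  Submodule.isClosed_topologicalClosure _

theorem isSeparable_orbitSpan : TopologicalSpace.IsSeparable (orbitSpan L x : Set H) := by
  have h : ((Set.range fun n : ℕ => (L ^ n) x) ∪ Set.range fun n : ℕ => (adjoint L ^ n) x).Countable :=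
    (Set.countable_range _).union (Set.countable_range _)
  exact (h.isSeparable.span (R := ℂ)).closure

theorem orbitSpan_le {W : Submodule ℂ H} (hW : IsClosed (W : Set H)) (hx : x ∈ W)
    (h1 : ∀ y ∈ W, L y ∈ W) (h2 : ∀ y ∈ W, adjoint L y ∈ W) : orbitSpan L x ≤ W := by
  refine Submodule.topologicalClosure_minimal _ (Submodule.span_le.2 ?_) hW
  rintro _ (⟨n, rfl⟩ | ⟨n, rfl⟩)
  · change (L ^ n) x ∈ W
    induction n with
    | zero => exact hx
    | succ n ih => rw [pow_succ']; exact h1 _ ih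
  · change (adjoint L ^ n) x ∈ W
    induction n with
    | zero => exact hx
    | succ n ih => rw [pow_succ']; exact h2 _ ih

theorem orbitSpan_adjoint : orbitSpan (adjoint L) x = orbitSpan L x := by
  rw [orbitSpan, orbitSpan, adjoint_adjoint, Set.union_comm]

theorem apply_mem_orbitSpan (hL : ‖L‖ ≤ 1) (hx : x ∈ unitaryPart L) {y : H}
    (hy : y ∈ orbitSpan L x) :
    L y ∈ orbitSpan L x := by
  refine Submodule.topologicalClosure_minimal _ (t := (orbitSpan L x).comap L.toLinearMap)
    (Submodule.span_le.2 ?_) (isClosed_orbitSpan.preimage L.continuous) hy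
  have hsub : ∀ z ∈ (Set.range fun n : ℕ => (L ^ n) x) ∪ Set.range fun n : ℕ => (adjoint L ^ n) x,
      z ∈ orbitSpan L x := fun z hz =>
    Submodule.le_topologicalClosure _ (Submodule.subset_span hz)
  rintro _ (⟨n, rfl⟩ | ⟨n, rfl⟩)
  · exact hsub _ (Or.inl ⟨n + 1, by dsimp only; rw [pow_succ']; rfl⟩)
  · rcases n with _ | n
    · exact hsub _ (Or.inl ⟨1, by simp⟩)
    · have e : L ((adjoint L ^ (n + 1)) x) = (adjoint L ^ n) x := by
        rw [pow_succ']
        exact apply_adjoint_of_mem_unitaryPart (adjoint_pow_mem_unitaryPart hL hx n)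
      change L ((adjoint L ^ (n + 1)) x) ∈ orbitSpan L x
      rw [e]
      exact hsub _ (Or.inr ⟨n, rfl⟩)

theorem adjoint_apply_mem_orbitSpan (hL : ‖L‖ ≤ 1) (hx : x ∈ unitaryPart L) {y : H}
    (hy : y ∈ orbitSpan L x) : adjoint L y ∈ orbitSpan L x := by
  rw [← orbitSpan_adjoint] at hy ⊢
  exact apply_mem_orbitSpan (by rwa [LinearIsometryEquiv.norm_map]) (by rwa [unitaryPart_adjoint]) hy

end

end Wandering

/-! ### The inner function of a wandering subspace -/

section InnerFunction

open ContinuousLinearMap Metric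

variable {E : Type u} [NormedAddCommGroup E] [InnerProductSpace ℂ E]

/-- The `n`-th Fourier coefficient of the functions in a subspace of `L²`. -/
def coeffOn (F : Submodule ℂ (LTwo E)) (n : ℕ) : F →L[ℂ] E := fourierCoeffCLM (n : ℤ) ∘L F.subtypeL

theorem coeffOn_apply (F : Submodule ℂ (LTwo E)) (n : ℕ) (x : F) :
    coeffOn F n x = fourierCoeff (((x : LTwo E)) : Torus → E) n := rfl

theorem norm_coeffOn_le (F : Submodule ℂ (LTwo E)) (n : ℕ) : ‖coeffOn F n‖ ≤ 1 :=
  opNorm_le_bound _ zero_le_one fun x => by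
    rw [coeffOn_apply, one_mul]; exact norm_fourierCoeff_le _ _

/-- The analytic extension to the disc of the functions in a subspace `F` of `H²`, as an
operator-valued function: `Θ(z) x = ∑ zⁿ x̂(n)`. -/
def evalDisc (F : Submodule ℂ (LTwo E)) (z : ℂ) : F →L[ℂ] E := ∑' n : ℕ, z ^ n • coeffOn F n

variable [CompleteSpace E] {F : Submodule ℂ (LTwo E)}

section PowerSeries

variable {G : Type*} [NormedAddCommGroup G] [NormedSpace ℂ G] {c : ℕ → G}

theorem norm_pow_smul_le (hc : ∀ n, ‖c n‖ ≤ 1) {ρ : ℝ} {z : ℂ} (hz : ‖z‖ ≤ ρ) (n : ℕ) :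
    ‖z ^ n • c n‖ ≤ ρ ^ n := by
  rw [norm_smul, norm_pow]
  refine (mul_le_of_le_one_right (by positivity) (hc n)).trans ?_
  gcongr

variable [CompleteSpace G]

theorem summable_pow_smul (hc : ∀ n, ‖c n‖ ≤ 1) {z : ℂ} (hz : z ∈ ball (0 : ℂ) 1) :
    Summable fun n : ℕ => z ^ n • c n :=
  Summable.of_norm_bounded (summable_geometric_of_lt_one (norm_nonneg z) (mem_ball_zero_iff.1 hz))
    fun n => norm_pow_smul_le hc le_rfl n

theorem differentiableOn_tsum_pow_smul (hc : ∀ n, ‖c n‖ ≤ 1) :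
    DifferentiableOn ℂ (fun z : ℂ => ∑' n : ℕ, z ^ n • c n) (ball 0 1) := by
  intro z hz
  obtain ⟨ρ, h1, h2⟩ := exists_between (mem_ball_zero_iff.1 hz)
  have h : DifferentiableOn ℂ (fun z : ℂ => ∑' n : ℕ, z ^ n • c n) (ball 0 ρ) :=
    Complex.differentiableOn_tsum_of_summable_norm
      (summable_geometric_of_lt_one ((norm_nonneg z).trans h1.le) h2)
      (fun n => by fun_prop) isOpen_ball fun n w hw =>
        norm_pow_smul_le hc (mem_ball_zero_iff.1 hw).le n
  exact (h.differentiableAt (isOpen_ball.mem_nhds (mem_ball_zero_iff.2 h1))).differentiableWithinAt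

end PowerSeries

theorem hasSum_evalDisc {z : ℂ} (hz : z ∈ ball (0 : ℂ) 1) :
    HasSum (fun n : ℕ => z ^ n • coeffOn F n) (evalDisc F z) :=
  (summable_pow_smul (G := F →L[ℂ] E) (c := coeffOn F) (norm_coeffOn_le F) hz).hasSum

theorem differentiableOn_evalDisc : DifferentiableOn ℂ (evalDisc F) (ball 0 1) :=
  differentiableOn_tsum_pow_smul (G := F →L[ℂ] E) (c := coeffOn F) (norm_coeffOn_le F)

theorem evalDisc_apply_eq_poissonIntegral (hF : F ≤ HTwo E) {r : ℝ} (hr : 0 ≤ r) (hr1 : r < 1)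
    (t : Torus) (x : F) : evalDisc F ((r : ℂ) * toCircle t) x =
      ∫ s, (poissonKernel r (t - s) : ℂ) • ((x : LTwo E) : Torus → E) s ∂leb := by
  have h1 : HasSum (fun n : ℕ => ((r : ℂ) * toCircle t) ^ n •
      fourierCoeff ((x : LTwo E) : Torus → E) (n : ℤ)) (evalDisc F ((r : ℂ) * toCircle t) x) :=
    (hasSum_evalDisc (F := F) (mul_toCircle_mem_ball hr hr1 t)).mapL
      (ContinuousLinearMap.apply ℂ E x)
  have h2 := hasSum_poissonIntegral (integrable_LTwo (x : LTwo E)) hr hr1 t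
  rw [← Function.Injective.hasSum_iff Nat.cast_injective (fun n hn => ?_)] at h2
  · refine h1.unique ?_
    convert h2 using 1
    funext n
    rw [mul_pow, ← coe_fourier_natCast]
    rfl
  · have hn' : n < 0 := by
      by_contra h
      exact hn ⟨n.toNat, Int.toNat_of_nonneg (not_lt.1 h)⟩
    rw [hF x.2 n hn', smul_zero]

theorem exists_eq_mul_toCircle (z : ℂ) : ∃ t : Torus, z = (‖z‖ : ℂ) * toCircle t := by
  refine ⟨((z.arg / (2 * Real.pi) : ℝ) : Torus), ?_⟩
  rw [toCircle_apply_mk, Circle.coe_exp]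
  have e : 2 * Real.pi / 1 * (z.arg / (2 * Real.pi)) = z.arg := by
    field_simp
  rw [e, Complex.norm_mul_exp_arg_mul_I]

theorem norm_evalDisc_le (hF : F ≤ HTwo E)
    (hn : ∀ x ∈ F, ∀ᵐ t ∂leb, ‖(x : Torus → E) t‖ = ‖x‖) {z : ℂ} (hz : z ∈ ball (0 : ℂ) 1) :
    ‖evalDisc F z‖ ≤ 1 := by
  obtain ⟨t, ht⟩ := exists_eq_mul_toCircle z
  rw [mem_ball_zero_iff] at hz
  refine opNorm_le_bound _ zero_le_one fun x => ?_
  rw [ht, evalDisc_apply_eq_poissonIntegral hF (norm_nonneg z) hz, one_mul]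
  have hP : Integrable (fun s => poissonKernel ‖z‖ (t - s)) leb :=
    ((continuous_poissonKernel (norm_nonneg z) hz).comp (by fun_prop)).integrable_of_hasCompactSupport
      (HasCompactSupport.of_compactSpace _)
  refine (norm_integral_le_of_norm_le (hP.mul_const ‖(x : LTwo E)‖) ?_).trans (le_of_eq ?_)
  · filter_upwards [hn x x.2] with s hs
    rw [norm_smul, hs, Complex.norm_real, Real.norm_eq_abs,
      abs_of_nonneg (poissonKernel_nonneg (norm_nonneg z) hz _)]
  · rw [integral_mul_const, integral_poissonKernel (norm_nonneg z) hz, one_mul, Submodule.norm_coe]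

open Classical in
/-- The strong radial limit of `evalDisc F` where it exists, and `0` elsewhere. -/
def evalBoundary (F : Submodule ℂ (LTwo E)) (t : Torus) : F →L[ℂ] E :=
  if h : ∃ B : F →L[ℂ] E, ∀ x, Tendsto (fun r : ℝ => evalDisc F ((r : ℂ) * toCircle t) x) (𝓝[<] 1)
    (𝓝 (B x)) then h.choose else 0

theorem ae_tendsto_evalDisc_apply (hF : F ≤ HTwo E) (x : F) :
    ∀ᵐ t ∂leb, Tendsto (fun r : ℝ => evalDisc F ((r : ℂ) * toCircle t) x) (𝓝[<] 1)
      (𝓝 (((x : LTwo E) : Torus → E) t)) := by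
  filter_upwards [ae_tendsto_poissonIntegral (integrable_LTwo (x : LTwo E))] with t ht
  refine ht.congr' ?_
  filter_upwards [Ioo_mem_nhdsLT (show (0 : ℝ) < 1 by norm_num)] with r hr
  exact (evalDisc_apply_eq_poissonIntegral hF hr.1.le hr.2 t x).symm

/-- The operators `evalDisc F` have strong radial limits almost everywhere: Fatou's theorem gives
the limits on a countable dense set, and the operators are uniformly bounded. -/
theorem ae_tendsto_evalDisc (hFc : IsClosed (F : Set (LTwo E)))
    (hFs : TopologicalSpace.IsSeparable (F : Set (LTwo E))) (hF : F ≤ HTwo E)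
    (hn : ∀ x ∈ F, ∀ᵐ t ∂leb, ‖(x : Torus → E) t‖ = ‖x‖) :
    ∀ᵐ t ∂leb, ∀ x, Tendsto (fun r : ℝ => evalDisc F ((r : ℂ) * toCircle t) x) (𝓝[<] 1)
      (𝓝 (evalBoundary F t x)) := by
  have : TopologicalSpace.SeparableSpace F := hFs.separableSpace
  have : CompleteSpace F := hFc.completeSpace_coe
  have h := ae_all_iff.2 fun k => ae_tendsto_evalDisc_apply hF (TopologicalSpace.denseSeq F k)
  filter_upwards [h] with t ht
  have hex : ∃ B : F →L[ℂ] E, ∀ x,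
      Tendsto (fun r : ℝ => evalDisc F ((r : ℂ) * toCircle t) x) (𝓝[<] 1) (𝓝 (B x)) := by
    refine exists_clm_tendsto ?_
    set N := nullSubspace (fun p : ℝ × ℝ => evalDisc F ((p.1 : ℂ) * toCircle t) -
      evalDisc F ((p.2 : ℂ) * toCircle t)) radialPairs with hN
    have hclosed : IsClosed (N : Set F) := by
      refine isClosed_nullSubspace (C := 2) ?_
      filter_upwards [eventually_radialPairs] with p hp
      refine (norm_sub_le (evalDisc F ((p.1 : ℂ) * toCircle t))
        (evalDisc F ((p.2 : ℂ) * toCircle t))).trans ?_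
      linarith [norm_evalDisc_le hF hn (mul_toCircle_mem_ball hp.1.1 hp.1.2 t),
        norm_evalDisc_le hF hn (mul_toCircle_mem_ball hp.2.1 hp.2.2 t)]
    refine Submodule.eq_top_iff'.2 fun x => ?_
    refine closure_minimal (s := Set.range (TopologicalSpace.denseSeq F)) ?_ hclosed
      (TopologicalSpace.denseRange_denseSeq F x)
    rintro _ ⟨k, rfl⟩
    have h1 := (ht k).comp (tendsto_fst (f := 𝓝[<] (1 : ℝ)) (g := 𝓝[<] (1 : ℝ)))
    have h2 := (ht k).comp (tendsto_snd (f := 𝓝[<] (1 : ℝ)) (g := 𝓝[<] (1 : ℝ)))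
    have h3 := h1.sub h2
    rw [sub_self] at h3
    exact h3
  rw [evalBoundary, dif_pos hex]
  exact hex.choose_spec

theorem ae_evalBoundary_apply (hFc : IsClosed (F : Set (LTwo E)))
    (hFs : TopologicalSpace.IsSeparable (F : Set (LTwo E))) (hF : F ≤ HTwo E)
    (hn : ∀ x ∈ F, ∀ᵐ t ∂leb, ‖(x : Torus → E) t‖ = ‖x‖) (x : F) :
    ∀ᵐ t ∂leb, evalBoundary F t x = ((x : LTwo E) : Torus → E) t := by
  filter_upwards [ae_tendsto_evalDisc hFc hFs hF hn, ae_tendsto_evalDisc_apply hF x] with t h1 h2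
  exact tendsto_nhds_unique (h1 x) h2

theorem isInner_evalDisc (hFc : IsClosed (F : Set (LTwo E)))
    (hFs : TopologicalSpace.IsSeparable (F : Set (LTwo E))) (hF : F ≤ HTwo E)
    (hn : ∀ x ∈ F, ∀ᵐ t ∂leb, ‖(x : Torus → E) t‖ = ‖x‖) :
    IsInner (evalDisc F) (evalBoundary F) where
  differentiableOn := differentiableOn_evalDisc
  bounded := ⟨1, fun _ hz => norm_evalDisc_le hF hn hz⟩
  boundary := ae_tendsto_evalDisc hFc hFs hF hn
  isometry := by
    have : TopologicalSpace.SeparableSpace F := hFs.separableSpace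
    have h := ae_all_iff.2 fun k =>
      ae_evalBoundary_apply hFc hFs hF hn (TopologicalSpace.denseSeq F k)
    have h' := ae_all_iff.2 fun k => hn _ (TopologicalSpace.denseSeq F k).2
    filter_upwards [h, h'] with t h1 h2 x
    refine (TopologicalSpace.denseRange_denseSeq F).induction_on x
      (isClosed_eq (by fun_prop) (by fun_prop)) fun k => ?_
    rw [h1 k, h2 k, Submodule.norm_coe]

/-- If `U` is the restriction of the Laurent operator to `F`, the boundary values of `evalDisc F`
intertwine `U` with the symbol. -/
theorem ae_comp_evalBoundary (hFc : IsClosed (F : Set (LTwo E)))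
    (hFs : TopologicalSpace.IsSeparable (F : Set (LTwo E))) (hF : F ≤ HTwo E)
    (hn : ∀ x ∈ F, ∀ᵐ t ∂leb, ‖(x : Torus → E) t‖ = ‖x‖) {Φ : Torus → E →L[ℂ] E}
    (hΦ : IsLInfty Φ) {U : F →L[ℂ] F} (hU : ∀ x, (U x : LTwo E) = laurent hΦ x) :
    ∀ᵐ t ∂leb, Φ t ∘L evalBoundary F t = evalBoundary F t ∘L U := by
  have : TopologicalSpace.SeparableSpace F := hFs.separableSpace
  have h1 := ae_all_iff.2 fun k =>
    ae_evalBoundary_apply hFc hFs hF hn (TopologicalSpace.denseSeq F k)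
  have h2 := ae_all_iff.2 fun k =>
    ae_evalBoundary_apply hFc hFs hF hn (U (TopologicalSpace.denseSeq F k))
  have h3 := ae_all_iff.2 fun k =>
    coeFn_laurent hΦ ((TopologicalSpace.denseSeq F k : F) : LTwo E)
  filter_upwards [h1, h2, h3] with t h1 h2 h3
  refine ContinuousLinearMap.ext fun x => ?_
  refine (TopologicalSpace.denseRange_denseSeq F).induction_on x
    (isClosed_eq (by fun_prop) (by fun_prop)) fun k => ?_
  rw [comp_apply, comp_apply, h1 k, h2 k, hU, h3 k]

/-- If a contractive Toeplitz operator has a unitary part, then its symbol is intertwined with a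
unitary operator by an inner function: a wandering vector of the unitary part of the Laurent
operator, together with its orbit, spans a space of functions of constant norm on the circle. The
adjoint of `U` enters as a separate operator `U'`, since the completeness of `F` is itself part of the
conclusion. -/
theorem exists_inner_of_hasUnitaryPart {Φ : Torus → E →L[ℂ] E} (hΦ : IsLInfty Φ)
    (hT : ‖toeplitz hΦ‖ ≤ 1) (hU : HasUnitaryPart (toeplitz hΦ)) :
    ∃ F : Submodule ℂ (LTwo E), CompleteSpace F ∧ Nontrivial F ∧ ∃ U U' : F →L[ℂ] F,
      (∀ x y, inner ℂ (U' x) y = (inner ℂ x (U y) : ℂ)) ∧ U' * U = 1 ∧ U * U' = 1 ∧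
      IsInner (evalDisc F) (evalBoundary F) ∧
      ∀ᵐ t ∂leb, Φ t ∘L evalBoundary F t = evalBoundary F t ∘L U ∧
        adjoint (Φ t) ∘L evalBoundary F t = evalBoundary F t ∘L U' := by
  obtain ⟨M, hM0, -, hM⟩ := hU
  set L := laurent hΦ with hL
  have hL1 : ‖L‖ ≤ 1 := norm_laurent_le hΦ hT
  set N := unitaryPartIn L (HTwo E) with hN
  have hNc : IsClosed (N : Set (LTwo E)) := isClosed_unitaryPartIn (HTwo.isClosed E)
  have hN0 : N ≠ ⊥ := fun h => by
    obtain ⟨f, hf, hf0⟩ := Submodule.exists_mem_ne_zero_of_ne_bot hM0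
    have := coe_mem_unitaryPartIn hΦ hT hM hf
    rw [← hL, ← hN, h, Submodule.mem_bot] at this
    exact hf0 (Subtype.ext this)
  have hNS : ∀ {m : ℤ}, 0 ≤ m → ∀ f ∈ N, mulFourier m f ∈ N := fun hm f hf =>
    mulFourier_mem_unitaryPartIn hΦ hT hf hm
  obtain ⟨f, hf, hf0, hfw⟩ := exists_wandering hNc unitaryPartIn_le (hNS zero_le_one) hN0
  -- the wandering subspace `N ⊖ zN` is invariant under `L` and `L*`
  set W := N ⊓ (N.map (mulFourier (E := E) 1).toLinearMap)ᗮ with hW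
  have hWc : IsClosed (W : Set (LTwo E)) := hNc.inter (Submodule.isClosed_orthogonal _)
  have hmemW : ∀ {g}, g ∈ W ↔ g ∈ N ∧ ∀ h ∈ N, inner ℂ (mulFourier 1 h) g = 0 := fun {g} => by
    rw [hW, Submodule.mem_inf, Submodule.mem_orthogonal]
    refine and_congr_right fun _ => ⟨fun h k hk => h _ ⟨k, hk, rfl⟩, ?_⟩
    rintro h _ ⟨k, hk, rfl⟩
    exact h k hk
  have hLW : ∀ g ∈ W, L g ∈ W := fun g hg => by
    rw [hmemW] at hg ⊢
    refine ⟨apply_mem_unitaryPartIn hL1 hg.1, fun h hh => ?_⟩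
    rw [← adjoint_inner_left, hL, ← laurent_adjoint hΦ, laurent_mulFourier, laurent_adjoint hΦ]
    exact hg.2 _ (adjoint_apply_mem_unitaryPartIn hL1 hh)
  have hLW' : ∀ g ∈ W, adjoint L g ∈ W := fun g hg => by
    rw [hmemW] at hg ⊢
    refine ⟨adjoint_apply_mem_unitaryPartIn hL1 hg.1, fun h hh => ?_⟩
    rw [adjoint_inner_right, hL, laurent_mulFourier]
    exact hg.2 _ (apply_mem_unitaryPartIn hL1 hh)
  set F := orbitSpan L f with hF
  have hfU : f ∈ unitaryPart L := (mem_unitaryPartIn.1 hf).1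
  have hFW : F ≤ W := orbitSpan_le hWc (hmemW.2 ⟨hf, hfw⟩) hLW hLW'
  have hFH : F ≤ HTwo E := fun x hx => unitaryPartIn_le (hmemW.1 (hFW hx)).1
  have hFn : ∀ x ∈ F, ∀ᵐ t ∂leb, ‖(x : Torus → E) t‖ = ‖x‖ := fun x hx => by
    refine ae_norm_eq_of_wandering fun n hn => ?_
    have h1 := hmemW.1 (hFW hx)
    have e : mulFourier (n : ℤ) x = mulFourier 1 (mulFourier ((n : ℤ) - 1) x) := by
      rw [mulFourier_mulFourier, add_sub_cancel]
    rw [e]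
    exact h1.2 _ (hNS (by omega) x h1.1)
  have hFc : IsClosed (F : Set (LTwo E)) := isClosed_orbitSpan
  have hFs : TopologicalSpace.IsSeparable (F : Set (LTwo E)) := isSeparable_orbitSpan
  set U : F →L[ℂ] F := (L ∘L F.subtypeL).codRestrict F
    fun x => apply_mem_orbitSpan hL1 hfU x.2 with hUdef
  set U' : F →L[ℂ] F := (adjoint L ∘L F.subtypeL).codRestrict F
    fun x => adjoint_apply_mem_orbitSpan hL1 hfU x.2 with hU'def
  have hFU : ∀ x : F, (x : LTwo E) ∈ unitaryPart L := fun x =>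
    (mem_unitaryPartIn.1 (hmemW.1 (hFW x.2)).1).1
  refine ⟨F, hFc.completeSpace_coe, ⟨⟨⟨f, self_mem_orbitSpan⟩, 0, fun h => hf0 (congrArg Subtype.val h)⟩⟩,
    U, U', fun x y => adjoint_inner_left L _ _,
    ContinuousLinearMap.ext fun x => Subtype.ext (adjoint_apply_of_mem_unitaryPart (hFU x)),
    ContinuousLinearMap.ext fun x => Subtype.ext (apply_adjoint_of_mem_unitaryPart (hFU x)),
    isInner_evalDisc hFc hFs hFH hFn, ?_⟩
  exact (ae_comp_evalBoundary hFc hFs hFH hFn hΦ fun x => rfl).and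
    (ae_comp_evalBoundary hFc hFs hFH hFn hΦ.adjoint fun x => by rw [laurent_adjoint]; rfl)

/-- An isometry that intertwines `A` and `A*` with a unitary operator and its adjoint has a range that
is a unitary part of `A`. -/
theorem hasUnitaryPart_of_intertwining {F : Type*} [NormedAddCommGroup F] [InnerProductSpace ℂ F]
    [CompleteSpace F] [Nontrivial F] {A : E →L[ℂ] E} {V : F →L[ℂ] E} (hV : ∀ x, ‖V x‖ = ‖x‖)
    {U : F →L[ℂ] F} (hU : U ∈ unitary (F →L[ℂ] F)) (h1 : A ∘L V = V ∘L U)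
    (h2 : adjoint A ∘L V = V ∘L adjoint U) : HasUnitaryPart A := by
  have e1 : ∀ x, A (V x) = V (U x) := fun x => DFunLike.congr_fun h1 x
  have e2 : ∀ x, adjoint A (V x) = V (adjoint U x) := fun x => DFunLike.congr_fun h2 x
  have hU1 : ∀ x, ‖U x‖ = ‖x‖ := fun x => norm_map_of_mem_unitary hU x
  have hmap : ∀ x ∈ V.range, A x ∈ V.range := by
    rintro _ ⟨x, rfl⟩
    exact ⟨U x, (e1 x).symm⟩
  have hiso : Isometry V := AddMonoidHomClass.isometry_of_norm V hV
  refine ⟨V.range, fun h => ?_, ⟨?_, hmap, fun y hy => ?_⟩, ⟨hmap, ?_, ?_⟩⟩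
  · obtain ⟨x, hx⟩ := exists_ne (0 : F)
    have h3 : V x ∈ V.range := ⟨x, rfl⟩
    rw [h, Submodule.mem_bot] at h3
    exact hx (norm_eq_zero.1 (by rw [← hV x, h3, norm_zero]))
  · change IsClosed (Set.range V)
    exact hiso.isClosedEmbedding.isClosed_range
  · rw [Submodule.mem_orthogonal] at hy ⊢
    rintro _ ⟨x, rfl⟩
    rw [← adjoint_inner_left]
    refine hy _ ⟨adjoint U x, (e2 x).symm⟩
  · rintro _ ⟨x, rfl⟩
    change ‖A (V x)‖ = ‖V x‖
    rw [e1, hV, hV, hU1]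
  · rintro _ ⟨x, rfl⟩
    refine ⟨V (adjoint U x), ⟨_, rfl⟩, ?_⟩
    rw [e1]
    exact congrArg V (DFunLike.congr_fun (Unitary.mul_star_self_of_mem hU) x)

end InnerFunction

end UnitaryToeplitz

end

theorem theorem5p1 {E : Type u} [NormedAddCommGroup E] [InnerProductSpace ℂ E]
    [CompleteSpace E] (Φ : UnitaryToeplitz.Torus → E →L[ℂ] E) (hΦ : UnitaryToeplitz.IsLInfty Φ)
    (hcontr : ‖UnitaryToeplitz.toeplitz hΦ‖ ≤ 1)
    (hyp :
      (∃ N : Set UnitaryToeplitz.Torus, MeasurableSet N ∧ 0 < UnitaryToeplitz.leb N ∧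
        ∀ᵐ t ∂UnitaryToeplitz.leb, t ∈ N → UnitaryToeplitz.IsCNU (Φ t)) ∨
      ((∀ᵐ t ∂UnitaryToeplitz.leb, UnitaryToeplitz.HasUnitaryPart (Φ t)) ∧
        ∀ (F : Type u) [NormedAddCommGroup F] [InnerProductSpace ℂ F] [CompleteSpace F]
          [Nontrivial F], ∀ U ∈ unitary (F →L[ℂ] F),
          ¬ ∃ (Θ : ℂ → F →L[ℂ] E) (Θb : UnitaryToeplitz.Torus → F →L[ℂ] E),
            UnitaryToeplitz.IsInner Θ Θb ∧
            ∀ᵐ t ∂UnitaryToeplitz.leb, Φ t ∘L Θb t = Θb t ∘L U ∧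
              ContinuousLinearMap.adjoint (Φ t) ∘L Θb t =
                Θb t ∘L ContinuousLinearMap.adjoint U)) :
    UnitaryToeplitz.IsCNU (UnitaryToeplitz.toeplitz hΦ) ∧
      ∀ u : ℂ → ℂ, DifferentiableOn ℂ u (Metric.ball 0 1) →
        (∃ z ∈ Metric.ball (0 : ℂ) 1, u z ≠ 0) →
        (∀ z ∈ Metric.ball (0 : ℂ) 1, ‖u z‖ < 1) →
        ∃ A : UnitaryToeplitz.HTwo E →L[ℂ] UnitaryToeplitz.HTwo E,
          UnitaryToeplitz.IsFunctionalCalculus u (UnitaryToeplitz.toeplitz hΦ) A ∧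
            ‖A‖ ≤ 1 ∧ UnitaryToeplitz.IsCNU A := by
  have hcnu : UnitaryToeplitz.IsCNU (UnitaryToeplitz.toeplitz hΦ) := by
    intro hU
    obtain ⟨F, hFc, hFn, U, U', hadj, hU'U, hUU', hin, hae⟩ :=
      UnitaryToeplitz.exists_inner_of_hasUnitaryPart hΦ hcontr hU
    have hUadj : U' = ContinuousLinearMap.adjoint U := by
      rw [ContinuousLinearMap.eq_adjoint_iff]
      exact hadj
    have hUmem : U ∈ unitary (F →L[ℂ] F) := by
      rw [Unitary.mem_iff, ContinuousLinearMap.star_eq_adjoint, ← hUadj]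
      exact ⟨hU'U, hUU'⟩
    rw [hUadj] at hae
    rcases hyp with ⟨N, -, hN0, hN⟩ | ⟨-, hno⟩
    · refine hN0.ne' (measure_mono_null ?_ (ae_iff.1 (hN.and (hae.and hin.isometry))))
      rintro t ht ⟨h1, ⟨h2, h3⟩, h4⟩
      exact h1 ht (UnitaryToeplitz.hasUnitaryPart_of_intertwining h4 hUmem h2 h3)
    · exact hno F U hUmem ⟨_, _, hin, hae⟩
  refine ⟨hcnu, fun u hu _ hu1 => ?_⟩
  obtain ⟨A, hA1, hA⟩ := UnitaryToeplitz.exists_isFunctionalCalculus hu (fun z hz => (hu1 z hz).le)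
    hcontr hcnu
  refine ⟨A, ⟨fun r hr hr1 => ?_, hA⟩, hA1,
    UnitaryToeplitz.isCNU_of_tendsto_radialCalculus hu hu1 hcontr hcnu hA1 hA⟩
  exact (UnitaryToeplitz.hasSum_radialCalculus hu hcontr hr hr1).summable
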